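/- **Setting.** Let $S$ be a metric space with its Borel $\sigma$-algebra and a reference measure $ds$ (for instance $[0,\infty)$ or $\mathbb{R}^2$ with Lebesgue measure). On a probability space let $X_1,X_2,\dots$ be locally finite point processes on $S$ and let $\Lambda_t=\exp(G_t)$, $t\ge 1$, be random intensity functions on $S$, jointly measurable in $(\omega,s)$ and almost surely integrable on bounded Borel sets. Let $R\subset S$ be a bounded region, partitioned into Borel sets $R_1,\dots,R_d$ of positive finite volume, and let $Y_{tj}=\#(X_t\cap R_j)$, $\mathbf{Y}_t=(Y_{t1},\dots,Y_{td})^T$. **Assumptions.** * **A1.** Conditionally on $(\Lambda_t)_{t\ge1}$ the processes $X_t$ are independent, and $X_t$ is a Poisson process with intensity function $\Lambda_t$ (for bounded Borel $B$ the count $\#(X_t\cap B)$ is Poisson with rate $\int_B\Lambda_t(s)\,ds$, and counts on disjoint sets are independent); $(G_t(s))_{t\ge 1,\,s\in S}$ is a Gaussian process, stationary in $t$, with $E\,G_t(s)=\mu(s)$ and $\operatorname{cov}\{G_t(s),G_{t+k}(s')\}=\gamma_k(s,s')$ for all $t\ge1$, $k\ge 0$. * **A2.** $\sup_{R}|\mu|<\infty$,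 $\sup_{R\times R}|\gamma_k|<\infty$ for all $k\ge0$, and $\sup_{R\times R}|\gamma_k|\to0$ as $k\to\infty$. **Population quantities.** Let $\nu(s)=E\,\Lambda_t(s)$, $c_k(s,s')=E\{\Lambda_t(s)\Lambda_{t+k}(s')\}$ (these do not depend on $t$), $\nu_j=\int_{R_j}\nu(s)\,ds$, $C_{k,jj'}=\iint_{R_j\times R_{j'}}c_k(s,s')\,ds\,ds'$, and let $\Gamma_k$ be the $d\times d$ matrix with entries $$\Gamma_{k,jj'}=\log\left(\frac{C_{k,jj'}}{\nu_j\nu_{j'}}\right),\qquad k\ge 0 .$$ If $\operatorname{tr}\Gamma_0\neq0$, let $\rho_k=\|\Gamma_k\|_F/\operatorname{tr}\Gamma_0$, where $\|\cdot\|_F$ is the Frobenius norm. **Estimators.** Let $\hat\nu=\bar{\mathbf Y}=\frac1n\sum_{t=1}^n\mathbf Y_t$, $\hat C_0=\frac1n\sum_{t=1}^n\mathbf Y_t\mathbf Y_t^T-\operatorname{diag}(\bar{\mathbf Y})$, $\hat C_k=\frac1{n-k}\sum_{t=1}^{n-k}\mathbf Y_t\mathbf Y_{t+k}^T$ for $k\ge1$,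 $$\hat\Gamma_k=\log\{\operatorname{diag}(\hat\nu^{-1})\,\hat C_k\,\operatorname{diag}(\hat\nu^{-1})\},\qquad \hat\rho_k=\frac{\|\hat\Gamma_k\|_F}{\operatorname{tr}\hat\Gamma_0},$$ with inverse and logarithm taken entrywise (values at samples where these expressions are undefined are immaterial). **Theorem.** Under A1 and A2: 1. For every $k\ge0$, $\hat\Gamma_k\to\Gamma_k$ in probability as $n\to\infty$. 2. If $\operatorname{tr}\Gamma_0\neq0$, then for every $k\ge0$, $\hat\rho_k\to\rho_k$ in probability as $n\to\infty$. 3. If for some $k\ge1$ the autocovariance $\gamma_k$ vanishes identically on $R\times R$, then $\Gamma_k=0$ (and hence $\rho_k=0$). -/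

import Mathlib

open MeasureTheory ProbabilityTheory Filter Topology
open scoped ENNReal NNReal Matrix.Norms.Frobenius

namespace CoxSeries

noncomputable section

/-! ### Point processes and conditional Poisson processes

The state space `S` is a metric space with a reference measure `vol` (for instance `[0, ∞)` or
`ℝ²` with Lebesgue measure). Times are `t = 0, 1, 2, …`. -/

/-- The count `N(B) = #(X ∩ B)` of a random set `X`. -/
def count {Ω S : Type*} (X : Ω → Set S) (B : Set S) (ω : Ω) : ℕ∞ := (X ω ∩ B).encard

/-- `X` is a locally finite point process: a random set whose counts on bounded Borel sets are
random variables, almost surely finite (so that `X` is almost surely countable). -/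
structure IsPointProcess {Ω S : Type*} [MeasurableSpace Ω] [MetricSpace S] [MeasurableSpace S]
    (P : Measure Ω) (X : Ω → Set S) : Prop where
  measurable_count : ∀ B : Set S, MeasurableSet B → Bornology.IsBounded B → Measurable (count X B)
  finite_count : ∀ B : Set S, MeasurableSet B → Bornology.IsBounded B →
    ∀ᵐ ω ∂P, (X ω ∩ B).Finite

/-- The σ-algebra generated by a point process: the one generated by its counts on bounded
Borel sets. -/
@[reducible] def pointSigma {Ω S : Type*} [MetricSpace S] [MeasurableSpace S] (X : Ω → Set S) :
    MeasurableSpace Ω :=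
  ⨆ B : {B : Set S // MeasurableSet B ∧ Bornology.IsBounded B},
    MeasurableSpace.comap (count X B.1) inferInstance

/-- The σ-algebra generated by all the random variables `Λ t s`. -/
@[reducible] def latentSigma {Ω S : Type*} (Λ : ℕ → Ω → S → ℝ) : MeasurableSpace Ω :=
  ⨆ (t : ℕ) (s : S), MeasurableSpace.comap (fun ω => Λ t ω s) inferInstance

/-- Conditional independence, given `𝒢`, of a family of σ-algebras: conditional probabilities of
finite intersections factor almost surely. (Mathlib's `iCondIndep` is only defined
on standard Borel sample spaces, where it amounts to this.) -/
def CondIndepSigma {Ω ι : Type*} (𝒢 : MeasurableSpace Ω) [MeasurableSpace Ω] (P : Measure Ω)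
    (m : ι → MeasurableSpace Ω) : Prop :=
  ∀ (F : Finset ι) (A : ι → Set Ω), (∀ i ∈ F, MeasurableSet[m i] (A i)) →
    P⟦⋂ i ∈ F, A i | 𝒢⟧ =ᵐ[P] fun ω => ∏ i ∈ F, (P⟦A i | 𝒢⟧) ω

/-- Given `𝒢`, the point process `X` is a Poisson process with (random) intensity function `lam`:
`lam ω` is nonnegative and integrable on bounded sets, the count on a bounded Borel set `B` is
conditionally Poisson with rate `∫_B lam`, and the counts on disjoint bounded Borel sets
are conditionally independent. -/
structure IsCondPoisson {Ω S : Type*} (𝒢 : MeasurableSpace Ω) [MeasurableSpace Ω] [MetricSpace S]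
    [MeasurableSpace S] (P : Measure Ω) (vol : Measure S) (X : Ω → Set S)
    (lam : Ω → S → ℝ) : Prop where
  pointProcess : IsPointProcess P X
  nonneg : ∀ᵐ ω ∂P, ∀ s, 0 ≤ lam ω s
  locallyIntegrable : ∀ᵐ ω ∂P, ∀ B : Set S, MeasurableSet B → Bornology.IsBounded B →
    IntegrableOn (lam ω) B vol
  poisson : ∀ B : Set S, MeasurableSet B → Bornology.IsBounded B → ∀ m : ℕ,
    P⟦{ω | count X B ω = m} | 𝒢⟧ =ᵐ[P]
      fun ω => (poissonMeasure (∫ s in B, lam ω s ∂vol).toNNReal).real {m}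
  indep : ∀ (r : ℕ) (B : Fin r → Set S), (∀ i, MeasurableSet (B i)) →
    (∀ i, Bornology.IsBounded (B i)) → Pairwise (Function.onFun Disjoint B) →
    CondIndepSigma 𝒢 P (fun i => MeasurableSpace.comap (count X (B i)) inferInstance)

/-! ### The model -/

/-- The log-Gaussian intensity `Λ_t = exp G_t`. -/
def intensity {Ω S : Type*} (G : ℕ → Ω → S → ℝ) (t : ℕ) (ω : Ω) (s : S) : ℝ :=
  Real.exp (G t ω s)

/-- Assumption A1: given the intensities `Λ_t = exp G_t`, the `X_t` are independent Poisson
processes with intensities `Λ_t`, and `(G_t(s))_{t, s}` is a (jointly measurable) Gaussian process,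
stationary in `t`, with mean `μ` and autocovariances `γ k`. -/
structure AssumptionA1 {Ω S : Type*} [MeasurableSpace Ω] [MetricSpace S] [MeasurableSpace S]
    (P : Measure Ω) (vol : Measure S) (X : ℕ → Ω → Set S) (G : ℕ → Ω → S → ℝ)
    (μ : S → ℝ) (γ : ℕ → S → S → ℝ) : Prop where
  measurable : ∀ t, Measurable (fun p : Ω × S => G t p.1 p.2)
  gaussian : IsGaussianProcess (fun (p : ℕ × S) (ω : Ω) => G p.1 ω p.2) P
  mean : ∀ t s, ∫ ω, G t ω s ∂P = μ s
  autocov : ∀ t k s s', cov[fun ω => G t ω s, fun ω => G (t + k) ω s'; P] = γ k s s'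
  poisson : ∀ t, IsCondPoisson (latentSigma (intensity G)) P vol (X t) (intensity G t)
  condIndep : CondIndepSigma (latentSigma (intensity G)) P (fun t => pointSigma (X t))

/-- The sup norm of `f` over the set `A`. -/
def supNorm {α : Type*} (A : Set α) (f : α → ℝ) : ℝ≥0∞ := ⨆ a ∈ A, ‖f a‖ₑ

/-- Assumption A2, over the region `R`. -/
structure AssumptionA2 {S : Type*} (R : Set S) (μ : S → ℝ) (γ : ℕ → S → S → ℝ) : Prop where
  mean_bdd : supNorm R μ < ∞
  autocov_bdd : ∀ k, supNorm (R ×ˢ R) (fun p => γ k p.1 p.2) < ∞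
  autocov_tendsto : Tendsto (fun k => supNorm (R ×ˢ R) (fun p => γ k p.1 p.2)) atTop (𝓝 0)

/-- `bin 0, …, bin (d - 1)` is a partition of the bounded region `R` into Borel sets of positive
finite volume. -/
structure IsBinning {S : Type*} [MetricSpace S] [MeasurableSpace S] (vol : Measure S)
    (R : Set S) {d : ℕ} (bin : Fin d → Set S) : Prop where
  bounded : Bornology.IsBounded R
  measurableSet : ∀ j, MeasurableSet (bin j)
  disjoint : Pairwise (Function.onFun Disjoint bin)
  iUnion_eq : ⋃ j, bin j = R
  vol_pos : ∀ j, 0 < vol (bin j)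
  vol_lt_top : ∀ j, vol (bin j) < ∞

/-! ### Population quantities -/

/-- `ν(s) = E Λ_t(s)`; by stationarity the time `t = 0` may be used. -/
def nuFun {Ω S : Type*} [MeasurableSpace Ω] (P : Measure Ω) (G : ℕ → Ω → S → ℝ) (s : S) : ℝ :=
  ∫ ω, intensity G 0 ω s ∂P

/-- `c_k(s, s') = E {Λ_t(s) Λ_{t+k}(s')}`; by stationarity the time `t = 0` may be used. -/
def cFun {Ω S : Type*} [MeasurableSpace Ω] (P : Measure Ω) (G : ℕ → Ω → S → ℝ) (k : ℕ)
    (s s' : S) : ℝ :=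
  ∫ ω, intensity G 0 ω s * intensity G k ω s' ∂P

/-- `ν_j = ∫_{R_j} ν(s) ds`. -/
def nu {Ω S : Type*} [MeasurableSpace Ω] [MeasurableSpace S] (P : Measure Ω) (vol : Measure S)
    (G : ℕ → Ω → S → ℝ) {d : ℕ} (bin : Fin d → Set S) (j : Fin d) : ℝ :=
  ∫ s in bin j, nuFun P G s ∂vol

/-- `C_{k,jj'} = ∬_{R_j × R_j'} c_k(s, s') ds ds'`. -/
def C {Ω S : Type*} [MeasurableSpace Ω] [MeasurableSpace S] (P : Measure Ω) (vol : Measure S)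
    (G : ℕ → Ω → S → ℝ) {d : ℕ} (bin : Fin d → Set S) (k : ℕ) : Matrix (Fin d) (Fin d) ℝ :=
  Matrix.of fun j j' => ∫ s in bin j, ∫ s' in bin j', cFun P G k s s' ∂vol ∂vol

/-- `Γ_{k,jj'} = log (C_{k,jj'} / (ν_j ν_j'))`. -/
def Gam {Ω S : Type*} [MeasurableSpace Ω] [MeasurableSpace S] (P : Measure Ω) (vol : Measure S)
    (G : ℕ → Ω → S → ℝ) {d : ℕ} (bin : Fin d → Set S) (k : ℕ) : Matrix (Fin d) (Fin d) ℝ :=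
  Matrix.of fun j j' => Real.log (C P vol G bin k j j' / (nu P vol G bin j * nu P vol G bin j'))

/-- `ρ_k = ‖Γ_k‖_F / tr Γ_0` (the norm on matrices is the Frobenius norm). -/
def rho {Ω S : Type*} [MeasurableSpace Ω] [MeasurableSpace S] (P : Measure Ω) (vol : Measure S)
    (G : ℕ → Ω → S → ℝ) {d : ℕ} (bin : Fin d → Set S) (k : ℕ) : ℝ :=
  ‖Gam P vol G bin k‖ / (Gam P vol G bin 0).trace

/-! ### Estimators, from the observations `X_0, …, X_{n-1}` -/

/-- The bin counts `Y_{tj} = #(X_t ∩ R_j)`. -/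
def Y {Ω S : Type*} (X : ℕ → Ω → Set S) {d : ℕ} (bin : Fin d → Set S) (t : ℕ) (ω : Ω)
    (j : Fin d) : ℝ :=
  ((X t ω ∩ bin j).ncard : ℝ)

/-- `ν̂ = Ȳ`. -/
def nuHat {Ω S : Type*} (X : ℕ → Ω → Set S) {d : ℕ} (bin : Fin d → Set S) (n : ℕ) (ω : Ω) :
    Fin d → ℝ :=
  (n : ℝ)⁻¹ • ∑ t ∈ Finset.range n, Y X bin t ω

/-- `Ĉ_0 = n⁻¹ ∑ Y_t Y_tᵀ - diag Ȳ` and `Ĉ_k = (n - k)⁻¹ ∑_{t ≤ n - k} Y_t Y_{t+k}ᵀ` for `k ≥ 1`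
(only `n > k` matters). -/
def CHat {Ω S : Type*} (X : ℕ → Ω → Set S) {d : ℕ} (bin : Fin d → Set S) (n k : ℕ) (ω : Ω) :
    Matrix (Fin d) (Fin d) ℝ :=
  if k = 0 then
    (n : ℝ)⁻¹ • ∑ t ∈ Finset.range n, Matrix.vecMulVec (Y X bin t ω) (Y X bin t ω)
      - Matrix.diagonal (nuHat X bin n ω)
  else
    ((n : ℝ) - (k : ℝ))⁻¹ •
      ∑ t ∈ Finset.range (n - k), Matrix.vecMulVec (Y X bin t ω) (Y X bin (t + k) ω)

/-- `Γ̂_k = log {diag(ν̂⁻¹) Ĉ_k diag(ν̂⁻¹)}`, inverse and logarithm being componentwise. -/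
def GamHat {Ω S : Type*} (X : ℕ → Ω → Set S) {d : ℕ} (bin : Fin d → Set S) (n k : ℕ) (ω : Ω) :
    Matrix (Fin d) (Fin d) ℝ :=
  (Matrix.diagonal (fun j => (nuHat X bin n ω j)⁻¹) * CHat X bin n k ω *
    Matrix.diagonal (fun j => (nuHat X bin n ω j)⁻¹)).map Real.log

/-- `ρ̂_k = ‖Γ̂_k‖_F / tr Γ̂_0` (the norm on matrices is the Frobenius norm). -/
def rhoHat {Ω S : Type*} (X : ℕ → Ω → Set S) {d : ℕ} (bin : Fin d → Set S) (n k : ℕ) (ω : Ω) : ℝ :=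
  ‖GamHat X bin n k ω‖ / (GamHat X bin n 0 ω).trace

end

end CoxSeries

/-! Given the intensities, the bin counts are independent Poisson variables whose rates are the
random bin masses `binMass`, the integrals of `Λ_t` over the bins. The `a`-th factorial moment of a
Poisson variable is the `a`-th power of its rate, so every joint factorial moment of counts equals
the corresponding joint moment of masses (`lintegral_countMonomial`). This removes the Poisson noise
exactly, and it is why `diag Ȳ` is subtracted in `Ĉ_0`.

By Tonelli, a joint moment of masses is an integral over a product of bins of `E ∏ Λ = exp
(logMoment)`, where `logMoment` is the sum of the means plus half the sum of all covariances. The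
explicit exponent gives stationarity, finiteness and positivity. It also gives decorrelation:
merging two groups of times adds only the cross covariances, so if these are bounded by a sum `δ`,
the moment of the product is at most `exp δ` times the product of the moments
(`lintegral_prod_binMass_mul_le`). When one group is shifted by `h`, A2 sends `δ` to 0.

An upper bound on covariances is all that Chebyshev's inequality needs, so no ergodic theorem is
involved: averages of lagged count monomials converge to their means
(`tendstoInProb_average_countMonomial`). One factor gives `ν̂` and two factors give `Ĉ_k`. The
limits are positive, so the logarithm is continuous there, and `Γ̂_k`, `ρ̂_k` follow by continuous
mapping. For the last claim, `c_k(s,s') = ν(s) ν(s') exp γ_k(s,s')`, so `γ_k = 0` makes the ratio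
inside the logarithm equal to 1. -/

namespace CoxSeries

/-! ### Convergence in probability to a constant -/

section ConvergenceToConstant

variable {Ω ι : Type*} [MeasurableSpace Ω] {P : Measure Ω} {l : Filter ι}

/-- Convergence in probability to a constant, in terms of neighbourhoods. -/
def TendstoInProb {E : Type*} [TopologicalSpace E] (P : Measure Ω) (f : ι → Ω → E)
    (l : Filter ι) (c : E) : Prop :=
  ∀ U ∈ 𝓝 c, Tendsto (fun i => P {ω | f i ω ∉ U}) l (𝓝 0)

/-- In the neighbourhood form, continuous mapping is taking a preimage and joint convergence is a
finite union bound. The metric form is needed only for Chebyshev and for the final statement. -/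
lemma tendstoInProb_iff {E : Type*} [PseudoMetricSpace E] {f : ι → Ω → E} {c : E} :
    TendstoInProb P f l c ↔ TendstoInMeasure P f l (fun _ => c) := by
  rw [tendstoInMeasure_iff_dist]
  constructor
  · intro h ε hε
    refine (h _ (Metric.ball_mem_nhds c hε)).congr fun i => ?_
    simp [Metric.mem_ball]
  · intro h U hU
    obtain ⟨ε, hε, hεU⟩ := Metric.mem_nhds_iff.1 hU
    refine tendsto_of_tendsto_of_tendsto_of_le_of_le tendsto_const_nhds (h ε hε)
      (fun _ => zero_le) fun i => measure_mono fun ω hω => ?_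
    by_contra hlt
    exact hω (hεU (Metric.mem_ball.2 (not_le.1 hlt)))

lemma TendstoInProb.comp_continuousAt {E F : Type*} [TopologicalSpace E] [TopologicalSpace F]
    {f : ι → Ω → E} {c : E} (hf : TendstoInProb P f l c) {φ : E → F} (hφ : ContinuousAt φ c) :
    TendstoInProb P (fun i ω => φ (f i ω)) l (φ c) :=
  fun _ hU => hf _ (hφ hU)

lemma TendstoInProb.prodMk {E F : Type*} [TopologicalSpace E] [TopologicalSpace F]
    {f : ι → Ω → E} {g : ι → Ω → F} {c : E} {c' : F} (hf : TendstoInProb P f l c)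
    (hg : TendstoInProb P g l c') :
    TendstoInProb P (fun i ω => (f i ω, g i ω)) l (c, c') := by
  intro U hU
  obtain ⟨u, hu, v, hv, huv⟩ := mem_nhds_prod_iff.1 hU
  have := (hf u hu).add (hg v hv)
  rw [add_zero] at this
  refine tendsto_of_tendsto_of_tendsto_of_le_of_le tendsto_const_nhds this
    (fun _ => zero_le) fun i => (measure_mono fun ω hω => ?_).trans (measure_union_le _ _)
  by_contra hn
  simp only [Set.mem_union, Set.mem_ofPred_eq, not_or, not_not] at hn
  exact hω (huv ⟨hn.1, hn.2⟩)

lemma TendstoInProb.pi {κ : Type*} [Fintype κ] {E : κ → Type*} [∀ a, TopologicalSpace (E a)]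
    {f : ι → Ω → ∀ a, E a} {c : ∀ a, E a}
    (hf : ∀ a, TendstoInProb P (fun i ω => f i ω a) l (c a)) : TendstoInProb P f l c := by
  intro U hU
  rw [nhds_pi, Filter.mem_pi'] at hU
  obtain ⟨I, u, hu, hUI⟩ := hU
  have := tendsto_finsetSum (s := Finset.univ) fun a _ => hf a (u a) (hu a)
  rw [Finset.sum_const_zero] at this
  refine tendsto_of_tendsto_of_tendsto_of_le_of_le tendsto_const_nhds this
    (fun _ => zero_le) fun i => (measure_mono fun ω hω => ?_).trans
      (measure_biUnion_finset_le Finset.univ fun a => {ω | f i ω a ∉ u a})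
  by_contra hn
  simp only [Set.mem_iUnion, not_exists, Set.mem_ofPred_eq, not_not] at hn
  exact hω (hUI fun a _ => hn a (Finset.mem_univ a))

lemma TendstoInProb.congr' {E : Type*} [TopologicalSpace E] {f g : ι → Ω → E} {c : E}
    (hf : TendstoInProb P f l c) (h : ∀ᶠ i in l, f i =ᵐ[P] g i) : TendstoInProb P g l c := by
  intro U hU
  refine (hf U hU).congr' (h.mono fun i hi => measure_congr ?_)
  filter_upwards [hi] with ω hω
  exact propext (by change f i ω ∉ U ↔ g i ω ∉ U; rw [hω])

lemma TendstoInProb.comp_tendsto {κ E : Type*} [TopologicalSpace E] {f : ι → Ω → E} {c : E}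
    (hf : TendstoInProb P f l c) {l' : Filter κ} {u : κ → ι} (hu : Tendsto u l' l) :
    TendstoInProb P (fun i => f (u i)) l' c :=
  fun U hU => (hf U hU).comp hu

end ConvergenceToConstant

/-! ### A weak law of large numbers for asymptotically uncorrelated sequences -/

/-- Each lag occurs at most `n` times on either side of the diagonal. Only upper bounds on the mixed
moments enter. -/
lemma integral_sum_sq_le {Ω : Type*} [MeasurableSpace Ω] {P : Measure Ω} {W : ℕ → Ω → ℝ}
    (hW : ∀ t, MemLp (W t) 2 P) {c : ℕ → ℝ} (hc : ∀ h, 0 ≤ c h)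
    (hcov : ∀ t h, ∫ ω, W t ω * W (t + h) ω ∂P ≤ c h) (n : ℕ) :
    ∫ ω, (∑ t ∈ Finset.range n, W t ω) ^ 2 ∂P ≤ 2 * n * ∑ h ∈ Finset.range n, c h := by
  have hint : ∀ t u, Integrable (fun ω => W t ω * W u ω) P :=
    fun t u => (hW t).integrable_mul (hW u)
  induction n with
  | zero => simp
  | succ n ih =>
    have hS : MemLp (fun ω => ∑ t ∈ Finset.range n, W t ω) 2 P :=
      memLp_finsetSum _ fun t _ => hW t
    have hexp : ∀ ω, (∑ t ∈ Finset.range (n + 1), W t ω) ^ 2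
        = (∑ t ∈ Finset.range n, W t ω) ^ 2
          + (2 * ∑ t ∈ Finset.range n, W t ω * W n ω + W n ω * W n ω) := by
      intro ω
      rw [Finset.sum_range_succ, ← Finset.sum_mul]
      ring
    have hcross : ∫ ω, ∑ t ∈ Finset.range n, W t ω * W n ω ∂P
        ≤ ∑ t ∈ Finset.range n, c (n - t) := by
      rw [integral_finsetSum _ fun t _ => hint t n]
      refine Finset.sum_le_sum fun t ht => ?_
      have := hcov t (n - t)
      rwa [Nat.add_sub_cancel' (Finset.mem_range.1 ht).le] at this
    have hrefl : ∑ t ∈ Finset.range n, c (n - t) + c 0 = ∑ h ∈ Finset.range (n + 1), c h := by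
      rw [← Finset.sum_range_reflect c (n + 1), Finset.sum_range_succ]
      simp
    have hT : 0 ≤ ∑ h ∈ Finset.range (n + 1), c h := Finset.sum_nonneg fun h _ => hc h
    have hmono : ∑ h ∈ Finset.range n, c h ≤ ∑ h ∈ Finset.range (n + 1), c h := by
      rw [Finset.sum_range_succ]
      linarith [hc n]
    have hnn := hcov n 0
    simp only [add_zero] at hnn
    simp_rw [hexp]
    have hi1 : Integrable (fun ω => ∑ t ∈ Finset.range n, W t ω * W n ω) P :=
      integrable_finsetSum _ fun t _ => hint t n
    have hi2 : Integrable
        (fun ω => 2 * ∑ t ∈ Finset.range n, W t ω * W n ω + W n ω * W n ω) P :=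
      (hi1.const_mul 2).add (hint n n)
    rw [integral_add hS.integrable_sq hi2,
      integral_add (hi1.const_mul 2) (hint n n), integral_const_mul]
    have h0 := hc 0
    have : 2 * (n : ℝ) * ∑ h ∈ Finset.range n, c h
        ≤ 2 * n * ∑ h ∈ Finset.range (n + 1), c h := by gcongr
    push_cast
    linarith

/-- A sequence with constant mean and asymptotically nonpositive correlations satisfies the weak
law of large numbers. -/
theorem tendstoInProb_average {Ω : Type*} [MeasurableSpace Ω] {P : Measure Ω}
    [IsProbabilityMeasure P] {Z : ℕ → Ω → ℝ} (hZ : ∀ t, MemLp (Z t) 2 P) {m : ℝ}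
    (hm : ∀ t, ∫ ω, Z t ω ∂P = m) {b : ℕ → ℝ} (hb : Tendsto b atTop (𝓝 0))
    (hcov : ∀ t h, ∫ ω, Z t ω * Z (t + h) ω ∂P ≤ m ^ 2 + b h) :
    TendstoInProb P (fun (n : ℕ) ω => (n : ℝ)⁻¹ * ∑ t ∈ Finset.range n, Z t ω) atTop m := by
  have hZi : ∀ t, Integrable (Z t) P := fun t => (hZ t).integrable one_le_two
  have hW : ∀ t, MemLp (fun ω => Z t ω - m) 2 P := fun t => (hZ t).sub (memLp_const m)
  -- The absolute value supplies the nonnegative bound required by `integral_sum_sq_le` and still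
  -- tends to 0.
  have hWcov : ∀ t h, ∫ ω, (Z t ω - m) * (Z (t + h) ω - m) ∂P ≤ |b h| := by
    intro t h
    have hexp : ∀ ω, (Z t ω - m) * (Z (t + h) ω - m)
        = Z t ω * Z (t + h) ω - (m * Z t ω + m * Z (t + h) ω - m ^ 2) := fun ω => by ring
    have hp : Integrable (fun ω => Z t ω * Z (t + h) ω) P := (hZ t).integrable_mul (hZ (t + h))
    have hs : Integrable (fun ω => m * Z t ω + m * Z (t + h) ω) P :=
      ((hZi t).const_mul m).add ((hZi (t + h)).const_mul m)
    have hd : Integrable (fun ω => m * Z t ω + m * Z (t + h) ω - m ^ 2) P :=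
      hs.sub (integrable_const _)
    simp_rw [hexp]
    rw [integral_sub hp hd, integral_sub hs (integrable_const _),
      integral_add ((hZi t).const_mul m) ((hZi (t + h)).const_mul m), integral_const_mul,
      integral_const_mul, hm, hm, integral_const]
    have h1 := hcov t h
    have h2 := le_abs_self (b h)
    simp only [probReal_univ, smul_eq_mul, one_mul]
    nlinarith
  have hsq := integral_sum_sq_le hW (fun h => abs_nonneg (b h)) hWcov
  have hces : Tendsto (fun n : ℕ => (n : ℝ)⁻¹ * ∑ h ∈ Finset.range n, |b h|) atTop (𝓝 0) := by
    simpa using hb.abs.cesaro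
  rw [tendstoInProb_iff, tendstoInMeasure_iff_measureReal_norm]
  intro ε hε
  have hlim := (hces.const_mul 2).const_mul (ε ^ 2)⁻¹
  simp only [mul_zero] at hlim
  refine squeeze_zero' (Eventually.of_forall fun _ => measureReal_nonneg) ?_ hlim
  filter_upwards [eventually_gt_atTop 0] with n hn
  have hn' : (0 : ℝ) < n := Nat.cast_pos.2 hn
  have hS : MemLp (fun ω => ∑ t ∈ Finset.range n, (Z t ω - m)) 2 P :=
    memLp_finsetSum _ fun t _ => hW t
  have hcheb := mul_meas_ge_le_integral_of_nonneg (μ := P)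
    (f := fun ω => (∑ t ∈ Finset.range n, (Z t ω - m)) ^ 2)
    (Eventually.of_forall fun ω => sq_nonneg _) hS.integrable_sq ((n * ε) ^ 2)
  have hset : {ω | ε ≤ ‖(n : ℝ)⁻¹ * ∑ t ∈ Finset.range n, Z t ω - m‖}
      ⊆ {ω | (n * ε) ^ 2 ≤ (∑ t ∈ Finset.range n, (Z t ω - m)) ^ 2} := by
    intro ω hω
    have heq : ∑ t ∈ Finset.range n, (Z t ω - m)
        = n * ((n : ℝ)⁻¹ * ∑ t ∈ Finset.range n, Z t ω - m) := by
      rw [Finset.sum_sub_distrib]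
      simp
      field_simp
    simp only [Set.mem_ofPred_eq] at hω ⊢
    rw [heq, ← sq_abs (_ * (_ - m)), abs_mul, abs_of_pos hn']
    rw [Real.norm_eq_abs] at hω
    gcongr
  have hle := (measureReal_mono hset).trans
    ((le_div_iff₀' (by positivity)).2 (hcheb.trans (hsq n)))
  refine hle.trans (le_of_eq ?_)
  field_simp

/-! ### Factorial moments of mixed Poisson vectors -/

/-- Terms below `a` vanish; shifting the rest by `a` cancels the falling factorial against `(n +
a)!` and leaves `r ^ a` times the total mass. -/
lemma lintegral_descFactorial_poissonMeasure (r : ℝ≥0) (a : ℕ) :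
    ∫⁻ m, (m.descFactorial a : ℝ≥0∞) ∂(poissonMeasure r) = (r : ℝ≥0∞) ^ a := by
  have hshift : ∀ n : ℕ, ((n + a).descFactorial a : ℝ≥0∞) * poissonMeasure r {n + a}
      = (r : ℝ≥0∞) ^ a * poissonMeasure r {n} := by
    intro n
    rw [poissonMeasure_singleton, poissonMeasure_singleton, ← ENNReal.ofReal_coe_nnreal,
      ← ENNReal.ofReal_natCast, ← ENNReal.ofReal_pow r.coe_nonneg,
      ← ENNReal.ofReal_mul (by positivity),
      ← ENNReal.ofReal_mul (by positivity)]
    congr 1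
    have hfac : ((n + a).factorial : ℝ) = n.factorial * (n + a).descFactorial a := by
      have := Nat.factorial_mul_descFactorial (Nat.le_add_left a n)
      rw [Nat.add_sub_cancel] at this
      exact_mod_cast this.symm
    have hpos : ((n + a).descFactorial a : ℝ) ≠ 0 := by
      have : 0 < (n + a).descFactorial a := Nat.descFactorial_pos.2 (Nat.le_add_left a n)
      positivity
    have hn : (n.factorial : ℝ) ≠ 0 := by positivity
    rw [hfac, pow_add]
    field_simp
  rw [lintegral_countable', ← Summable.sum_add_tsum_nat_add' (k := a) ENNReal.summable,
    Finset.sum_eq_zero, zero_add]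
  · simp_rw [hshift]
    rw [ENNReal.tsum_mul_left]
    have : ∑' n, poissonMeasure r {n} = 1 := by
      have h := lintegral_countable' (μ := poissonMeasure r) (fun _ : ℕ => (1 : ℝ≥0∞))
      simpa using h.symm
    rw [this, mul_one]
  · intro m hm
    rw [Nat.descFactorial_eq_zero_iff_lt.2 (Finset.mem_range.1 hm)]
    simp

lemma lintegral_pi_poissonMeasure_prod {ι : Type*} [Fintype ι] (r : ι → ℝ≥0)
    (g : ι → ℕ → ℝ≥0∞) :
    ∫⁻ x, ∏ i, g i (x i) ∂(Measure.pi fun i => poissonMeasure (r i))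
      = ∏ i, ∫⁻ m, g i m ∂(poissonMeasure (r i)) := by
  have hind : iIndepFun (fun i (x : ι → ℕ) => g i (x i))
      (Measure.pi fun i => poissonMeasure (r i)) :=
    iIndepFun_pi fun i => (measurable_of_countable (g i)).aemeasurable
  rw [lintegral_prod_eq_prod_lintegral_of_indepFun Finset.univ _ hind
    fun i => (measurable_of_countable (g i)).comp (measurable_pi_apply i)]
  refine Finset.prod_congr rfl fun i _ => ?_
  exact (measurePreserving_eval (fun i => poissonMeasure (r i)) i).lintegral_comp
    (measurable_of_countable (g i))

lemma measurable_poissonMeasure_singleton {Ω : Type*} [MeasurableSpace Ω] {r : Ω → ℝ≥0}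
    (hr : Measurable r) (m : ℕ) : Measurable fun ω => poissonMeasure (r ω) {m} := by
  simp_rw [poissonMeasure_singleton]
  fun_prop

/-- If `N` is conditionally a vector of independent Poisson variables with rates `r`, expectations
of products can be computed from the conditional expectations of the factors. -/
theorem lintegral_prod_comp_of_mixedPoisson {Ω ι : Type*} [MeasurableSpace Ω] {P : Measure Ω}
    [Fintype ι] {N : ι → Ω → ℕ} (hN : ∀ i, Measurable (N i)) {r : ι → Ω → ℝ≥0}
    (hr : ∀ i, Measurable (r i))
    (h : ∀ m : ι → ℕ, P {ω | ∀ i, N i ω = m i}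
      = ∫⁻ ω, ∏ i, poissonMeasure (r i ω) {m i} ∂P) (g : ι → ℕ → ℝ≥0∞) :
    ∫⁻ ω, ∏ i, g i (N i ω) ∂P = ∫⁻ ω, ∏ i, ∫⁻ m, g i m ∂(poissonMeasure (r i ω)) ∂P := by
  have hNm : Measurable fun ω i => N i ω := measurable_pi_lambda _ hN
  have hf : Measurable fun x : ι → ℕ => ∏ i, g i (x i) := measurable_of_countable _
  calc ∫⁻ ω, ∏ i, g i (N i ω) ∂P
      = ∫⁻ x, ∏ i, g i (x i) ∂(P.map fun ω i => N i ω) := (lintegral_map hf hNm).symm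
    _ = ∑' m : ι → ℕ, (∏ i, g i (m i)) * ∫⁻ ω, ∏ i, poissonMeasure (r i ω) {m i} ∂P := by
        rw [lintegral_countable']
        refine tsum_congr fun m => ?_
        rw [Measure.map_apply hNm (measurableSet_singleton m), ← h m]
        congr 2
        ext ω
        simp [funext_iff]
    _ = ∫⁻ ω, ∑' m : ι → ℕ, (∏ i, g i (m i)) * ∏ i, poissonMeasure (r i ω) {m i} ∂P := by
        have hmeas : ∀ m : ι → ℕ, Measurable fun ω => ∏ i, poissonMeasure (r i ω) {m i} :=
          fun m => Finset.measurable_prod _ fun i _ =>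
            measurable_poissonMeasure_singleton (hr i) (m i)
        rw [lintegral_tsum fun m => ((hmeas m).const_mul _).aemeasurable]
        exact tsum_congr fun m => (lintegral_const_mul _ (hmeas m)).symm
    _ = _ := by
        refine lintegral_congr fun ω => ?_
        rw [← lintegral_pi_poissonMeasure_prod, lintegral_countable']
        refine tsum_congr fun m => ?_
        rw [Measure.pi_singleton]

/-! ### The bin counts given the intensities -/

lemma latentSigma_le {Ω S : Type*} [MeasurableSpace Ω] [MeasurableSpace S]
    {G : ℕ → Ω → S → ℝ} (hG : ∀ t, Measurable fun p : Ω × S => G t p.1 p.2) :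
    latentSigma (intensity G) ≤ ‹MeasurableSpace Ω› := by
  refine iSup₂_le fun t s => Measurable.comap_le ?_
  exact Real.measurable_exp.comp ((hG t).comp (measurable_id.prodMk measurable_const))

section Model

variable {Ω S : Type*} [MeasurableSpace Ω] [MetricSpace S] [MeasurableSpace S]
  {P : Measure Ω} {vol : Measure S} {X : ℕ → Ω → Set S} {G : ℕ → Ω → S → ℝ}
  {μ : S → ℝ} {γ : ℕ → S → S → ℝ} {R : Set S} {d : ℕ} {bin : Fin d → Set S}

lemma IsBinning.bin_bounded (hbin : IsBinning vol R bin) (j : Fin d) :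
    Bornology.IsBounded (bin j) :=
  hbin.bounded.subset (hbin.iUnion_eq ▸ Set.subset_iUnion bin j)

/-- The number of points in a bin, as a natural number. -/
noncomputable def binCount (X : ℕ → Ω → Set S) (bin : Fin d → Set S) (p : ℕ × Fin d)
    (ω : Ω) : ℕ :=
  (X p.1 ω ∩ bin p.2).ncard

/-- The mass that the random intensity gives to a bin. -/
noncomputable def binMass (vol : Measure S) (G : ℕ → Ω → S → ℝ) (bin : Fin d → Set S)
    (p : ℕ × Fin d) (ω : Ω) : ℝ≥0∞ :=
  ∫⁻ s in bin p.2, ENNReal.ofReal (intensity G p.1 ω s) ∂vol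

lemma measurable_binCount (hbin : IsBinning vol R bin) (hA1 : AssumptionA1 P vol X G μ γ)
    (p : ℕ × Fin d) : Measurable (binCount X bin p) :=
  (measurable_of_countable ENat.toNat).comp
    ((hA1.poisson p.1).1.measurable_count _ (hbin.measurableSet p.2)
      (hbin.bin_bounded p.2))

lemma ae_binCount (hbin : IsBinning vol R bin) (hA1 : AssumptionA1 P vol X G μ γ)
    (p : ℕ × Fin d) : ∀ᵐ ω ∂P, count (X p.1) (bin p.2) ω = binCount X bin p ω := by
  filter_upwards [(hA1.poisson p.1).1.finite_count _ (hbin.measurableSet p.2)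
    (hbin.bin_bounded p.2)] with ω hω
  exact (Set.Finite.cast_ncard_eq hω).symm

lemma measurable_intensity (hA1 : AssumptionA1 P vol X G μ γ) (t : ℕ) :
    Measurable fun p : Ω × S => intensity G t p.1 p.2 :=
  Real.measurable_exp.comp (hA1.measurable t)

lemma IsBinning.isFiniteMeasure (hbin : IsBinning vol R bin) (j : Fin d) :
    IsFiniteMeasure (vol.restrict (bin j)) :=
  ⟨by simpa using hbin.vol_lt_top j⟩

lemma measurable_binMass (hbin : IsBinning vol R bin) (hA1 : AssumptionA1 P vol X G μ γ)
    (p : ℕ × Fin d) : Measurable (binMass vol G bin p) := by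
  have := hbin.isFiniteMeasure p.2
  exact (measurable_intensity hA1 p.1).ennreal_ofReal.lintegral_prod_right'

lemma ae_binMass (hbin : IsBinning vol R bin) (hA1 : AssumptionA1 P vol X G μ γ)
    (p : ℕ × Fin d) : ∀ᵐ ω ∂P, binMass vol G bin p ω
      = ENNReal.ofReal (∫ s in bin p.2, intensity G p.1 ω s ∂vol) := by
  filter_upwards [(hA1.poisson p.1).locallyIntegrable] with ω hω
  exact (ofReal_integral_eq_lintegral_ofReal
    (hω _ (hbin.measurableSet p.2) (hbin.bin_bounded p.2))
    (Eventually.of_forall fun s => (Real.exp_pos _).le)).symm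

/-- Conditional independence is used twice, across the bins at a fixed time and then across times;
integrating the conditional probability removes the conditioning. -/
lemma measureReal_forall_count_eq [IsProbabilityMeasure P] (hbin : IsBinning vol R bin)
    (hA1 : AssumptionA1 P vol X G μ γ) (T : ℕ) (m : ℕ → Fin d → ℕ) :
    P.real (⋂ t ∈ Finset.range T, ⋂ j ∈ Finset.univ, {ω | count (X t) (bin j) ω = m t j})
      = ∫ ω, ∏ t ∈ Finset.range T, ∏ j, (poissonMeasure
          (∫ s in bin j, intensity G t ω s ∂vol).toNNReal).real {m t j} ∂P := by
  have hle := latentSigma_le hA1.measurable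
  have hcount : ∀ t j, Measurable (count (X t) (bin j)) := fun t j =>
    (hA1.poisson t).1.measurable_count _ (hbin.measurableSet j) (hbin.bin_bounded j)
  have hsing : ∀ t j, MeasurableSet {ω | count (X t) (bin j) ω = m t j} := fun t j =>
    hcount t j (measurableSet_singleton _)
  have hinner : ∀ t, P⟦⋂ j ∈ Finset.univ, {ω | count (X t) (bin j) ω = m t j} |
        latentSigma (intensity G)⟧ =ᵐ[P] fun ω => ∏ j, (poissonMeasure
          (∫ s in bin j, intensity G t ω s ∂vol).toNNReal).real {m t j} := by
    intro t
    have h1 := (hA1.poisson t).indep d bin hbin.measurableSet hbin.bin_bounded hbin.disjoint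
      Finset.univ (fun j => {ω | count (X t) (bin j) ω = m t j})
      (fun j _ => ⟨{(m t j : ℕ∞)}, measurableSet_singleton _, rfl⟩)
    have h2 : ∀ᵐ ω ∂P, ∀ j, (P⟦{ω | count (X t) (bin j) ω = m t j} |
        latentSigma (intensity G)⟧) ω = (poissonMeasure
          (∫ s in bin j, intensity G t ω s ∂vol).toNNReal).real {m t j} :=
      ae_all_iff.2 fun j =>
        (hA1.poisson t).poisson _ (hbin.measurableSet j) (hbin.bin_bounded j) _
    filter_upwards [h1, h2] with ω hω1 hω2
    rw [hω1]
    exact Finset.prod_congr rfl fun j _ => hω2 j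
  have houter := hA1.condIndep (Finset.range T)
    (fun t => ⋂ j ∈ Finset.univ, {ω | count (X t) (bin j) ω = m t j}) (fun t _ => by
      refine Finset.measurableSet_biInter _ fun j _ => ?_
      have hcomap : MeasurableSpace.comap (count (X t) (bin j)) inferInstance
          ≤ pointSigma (X t) :=
        le_iSup (fun B : {B : Set S // MeasurableSet B ∧ Bornology.IsBounded B} =>
          MeasurableSpace.comap (count (X t) B.1) inferInstance)
          ⟨bin j, hbin.measurableSet j, hbin.bin_bounded j⟩
      exact hcomap _ ⟨{(m t j : ℕ∞)}, measurableSet_singleton _, rfl⟩)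
  have hA : MeasurableSet
      (⋂ t ∈ Finset.range T, ⋂ j ∈ Finset.univ, {ω | count (X t) (bin j) ω = m t j}) :=
    Finset.measurableSet_biInter _ fun t _ => Finset.measurableSet_biInter _ fun j _ => hsing t j
  have hint := integral_condExp (μ := P) hle (f := (⋂ t ∈ Finset.range T,
    ⋂ j ∈ Finset.univ, {ω | count (X t) (bin j) ω = m t j}).indicator fun _ => (1 : ℝ))
  rw [integral_indicator_const _ hA, smul_eq_mul, mul_one] at hint
  rw [← hint]
  refine integral_congr_ae (houter.trans ?_)
  filter_upwards [ae_all_iff.2 hinner] with ω hω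
  exact Finset.prod_congr rfl fun t _ => hω t

lemma measure_forall_binCount_eq [IsProbabilityMeasure P] (hbin : IsBinning vol R bin)
    (hA1 : AssumptionA1 P vol X G μ γ) (T : ℕ) (m : Fin T × Fin d → ℕ) :
    P {ω | ∀ i : Fin T × Fin d, binCount X bin (i.1, i.2) ω = m i}
      = ∫⁻ ω, ∏ i : Fin T × Fin d,
          poissonMeasure (binMass vol G bin (i.1, i.2) ω).toNNReal {m i} ∂P := by
  -- The value 0 for `t ≥ T` is never read.
  set m' : ℕ → Fin d → ℕ := fun t j => if h : t < T then m (⟨t, h⟩, j) else 0 with hm'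
  have hset : ({ω | ∀ i : Fin T × Fin d, binCount X bin (i.1, i.2) ω = m i} : Set Ω)
      =ᵐ[P] (⋂ t ∈ Finset.range T, ⋂ j ∈ Finset.univ,
        {ω | count (X t) (bin j) ω = m' t j} : Set Ω) := by
    filter_upwards [ae_all_iff.2 fun p => ae_binCount hbin hA1 p] with ω hω
    apply propext
    change (∀ i : Fin T × Fin d, binCount X bin (i.1, i.2) ω = m i) ↔
      ω ∈ ⋂ t ∈ Finset.range T, ⋂ j ∈ Finset.univ, {ω | count (X t) (bin j) ω = m' t j}
    simp only [Set.mem_iInter, Finset.mem_range, Finset.mem_univ, Set.mem_ofPred_eq]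
    constructor
    · intro h t ht j _
      rw [hω (t, j), h (⟨t, ht⟩, j), hm']
      simp [ht]
    · intro h i
      have := h i.1 i.1.2 i.2 trivial
      rw [hω (i.1, i.2)] at this
      simpa [hm'] using this
  rw [measure_congr hset, ← ofReal_measureReal, measureReal_forall_count_eq hbin hA1,
    ofReal_integral_eq_lintegral_ofReal]
  · refine lintegral_congr_ae ?_
    filter_upwards [ae_all_iff.2 fun p => ae_binMass hbin hA1 p] with ω hω
    rw [Finset.prod_range, ENNReal.ofReal_prod_of_nonneg
      fun t _ => Finset.prod_nonneg fun j _ => measureReal_nonneg, Fintype.prod_prod_type]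
    refine Finset.prod_congr rfl fun t _ => ?_
    rw [ENNReal.ofReal_prod_of_nonneg fun j _ => measureReal_nonneg]
    refine Finset.prod_congr rfl fun j _ => ?_
    rw [ofReal_measureReal, hω (t, j)]
    simp [hm', ENNReal.ofReal]
  · refine Integrable.of_bound (C := 1) (AEMeasurable.aestronglyMeasurable ?_) ?_
    -- Measurability is taken from the version with `binMass`, to which the rates are almost surely
    -- equal.
    · refine AEMeasurable.congr (f := fun ω => ∏ t ∈ Finset.range T, ∏ j,
        (poissonMeasure (binMass vol G bin (t, j) ω).toNNReal {m' t j}).toReal) ?_ ?_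
      · refine (Finset.measurable_prod _ fun t _ =>
          Finset.measurable_prod _ fun j _ => ?_).aemeasurable
        exact (measurable_poissonMeasure_singleton
          (measurable_binMass hbin hA1 _).ennreal_toNNReal _).ennreal_toReal
      · filter_upwards [ae_all_iff.2 fun p => ae_binMass hbin hA1 p] with ω hω
        refine Finset.prod_congr rfl fun t _ => Finset.prod_congr rfl fun j _ => ?_
        rw [hω (t, j), ENNReal.ofReal, ENNReal.toNNReal_coe]
        rfl
    · refine Eventually.of_forall fun ω => ?_
      rw [Real.norm_eq_abs, abs_of_nonneg (Finset.prod_nonneg fun t _ =>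
        Finset.prod_nonneg fun j _ => measureReal_nonneg)]
      refine Finset.prod_le_one (fun t _ => Finset.prod_nonneg fun j _ => measureReal_nonneg)
        fun t _ => Finset.prod_le_one (fun j _ => measureReal_nonneg) fun j _ =>
          measureReal_le_one
  · exact Eventually.of_forall fun ω => Finset.prod_nonneg fun t _ =>
      Finset.prod_nonneg fun j _ => measureReal_nonneg

/-- The product of falling factorials of bin counts with exponents `a`. -/
noncomputable def countMonomial (X : ℕ → Ω → Set S) (bin : Fin d → Set S)
    (a : ℕ × Fin d →₀ ℕ) (ω : Ω) : ℕ :=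
  a.prod fun p m => (binCount X bin p ω).descFactorial m

/-- The product of powers of bin masses with exponents `a`. -/
noncomputable def massMonomial (vol : Measure S) (G : ℕ → Ω → S → ℝ) (bin : Fin d → Set S)
    (a : ℕ × Fin d →₀ ℕ) (ω : Ω) : ℝ≥0∞ :=
  a.prod fun p m => binMass vol G bin p ω ^ m

/-- The joint factorial moments of the bin counts are the joint moments of the bin masses. -/
theorem lintegral_countMonomial [IsProbabilityMeasure P] (hbin : IsBinning vol R bin)
    (hA1 : AssumptionA1 P vol X G μ γ) (a : ℕ × Fin d →₀ ℕ) :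
    ∫⁻ ω, countMonomial X bin a ω ∂P = ∫⁻ ω, massMonomial vol G bin a ω ∂P := by
  -- The monomial involves finitely many times, so it extends to the full block of times below `T`;
  -- the added factors have exponent 0.
  obtain ⟨T, hT⟩ : ∃ T, ∀ p ∈ a.support, p.1 < T :=
    ⟨a.support.sup Prod.fst + 1, fun p hp =>
      Nat.lt_succ_of_le (Finset.le_sup (f := Prod.fst) hp)⟩
  have hsub : a.support ⊆ Finset.range T ×ˢ Finset.univ := fun p hp => by
    simpa using hT p hp
  have hprod : ∀ {M : Type} [CommMonoid M] (f : ℕ × Fin d → ℕ → M), (∀ p, f p 0 = 1) →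
      a.prod f = ∏ i : Fin T × Fin d, f (i.1, i.2) (a (i.1, i.2)) := by
    intro M _ f hf
    rw [Finsupp.prod_of_support_subset a hsub f fun p _ => hf p, Finset.prod_product,
      Finset.prod_range, Fintype.prod_prod_type]
  have hmain := lintegral_prod_comp_of_mixedPoisson (P := P)
    (N := fun i : Fin T × Fin d => binCount X bin (i.1, i.2))
    (r := fun i ω => (binMass vol G bin (i.1, i.2) ω).toNNReal)
    (fun i => measurable_binCount hbin hA1 _)
    (fun i => (measurable_binMass hbin hA1 _).ennreal_toNNReal)
    (measure_forall_binCount_eq hbin hA1 T)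
    (fun i m => (m.descFactorial (a (i.1, i.2)) : ℝ≥0∞))
  simp_rw [lintegral_descFactorial_poissonMeasure] at hmain
  calc ∫⁻ ω, countMonomial X bin a ω ∂P
      = ∫⁻ ω, ∏ i : Fin T × Fin d,
          ((binCount X bin (i.1, i.2) ω).descFactorial (a (i.1, i.2)) : ℝ≥0∞) ∂P := by
        refine lintegral_congr fun ω => ?_
        rw [countMonomial, hprod _ fun p => Nat.descFactorial_zero _, Nat.cast_prod]
    _ = _ := hmain
    _ = _ := by
        refine lintegral_congr_ae ?_
        filter_upwards [ae_all_iff.2 fun p => ae_binMass hbin hA1 p] with ω hω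
        rw [massMonomial, hprod _ fun p => pow_zero _]
        refine Finset.prod_congr rfl fun i _ => ?_
        rw [ENNReal.coe_toNNReal]
        rw [hω]
        exact ENNReal.ofReal_ne_top

end Model

/-! ### Exponential moments of Gaussian processes -/

lemma lintegral_pi_fin_prod {S : Type*} [MeasurableSpace S] {n : ℕ} (κ : Fin n → Measure S)
    [∀ i, SigmaFinite (κ i)] {f : Fin n → S → ℝ≥0∞} (hf : ∀ i, Measurable (f i)) :
    ∫⁻ x, ∏ i, f i (x i) ∂(Measure.pi κ) = ∏ i, ∫⁻ s, f i s ∂(κ i) := by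
  induction n with
  | zero => simp
  | succ n ih =>
    have hmp := (measurePreserving_piFinSuccAbove κ 0).symm
    have hF : Measurable fun x : Fin (n + 1) → S => ∏ i, f i (x i) :=
      Finset.measurable_prod _ fun i _ => (hf i).comp (measurable_pi_apply i)
    have hg : Measurable fun x : Fin n → S => ∏ i, f i.succ (x i) :=
      Finset.measurable_prod _ fun i _ => (hf i.succ).comp (measurable_pi_apply i)
    rw [← hmp.lintegral_comp hF, Fin.prod_univ_succ, ← ih (fun i => κ i.succ) fun i => hf i.succ,
      ← lintegral_prod_mul (hf 0).aemeasurable hg.aemeasurable]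
    refine lintegral_congr fun x => ?_
    rw [Fin.prod_univ_succ]
    rfl

lemma lintegral_exp_of_hasGaussianLaw {Ω : Type*} [MeasurableSpace Ω] {P : Measure Ω}
    {Z : Ω → ℝ} (hZ : HasGaussianLaw Z P) :
    ∫⁻ ω, ENNReal.ofReal (Real.exp (Z ω)) ∂P
      = ENNReal.ofReal (Real.exp (∫ ω, Z ω ∂P + Var[Z; P] / 2)) := by
  have := hZ.isProbabilityMeasure
  have hmgf := mgf_gaussianReal hZ.map_eq_gaussianReal 1
  have hint : Integrable (fun ω => Real.exp (Z ω)) P := by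
    -- The integral defining `mgf` is 0 by default without integrability, so positivity proves
    -- integrability.
    have hpos : 0 < mgf Z P 1 := by rw [hmgf]; exact Real.exp_pos _
    simpa using mgf_pos_iff.1 hpos
  rw [← ofReal_integral_eq_lintegral_ofReal hint
    (Eventually.of_forall fun ω => (Real.exp_pos _).le)]
  congr 1
  have h1 : mgf Z P 1 = ∫ ω, Real.exp (Z ω) ∂P := by simp [mgf]
  rw [← h1, hmgf, Real.coe_toNNReal _ (variance_nonneg _ _)]
  simp

/-- The product is the exponential of a Gaussian sum, whose variance is the double sum of
covariances. -/
lemma lintegral_prod_exp_of_isGaussianProcess {Ω T ι : Type*} [MeasurableSpace Ω] [Fintype ι]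
    {P : Measure Ω} {Z : T → Ω → ℝ} (hZ : IsGaussianProcess Z P) (p : ι → T) :
    ∫⁻ ω, ∏ i, ENNReal.ofReal (Real.exp (Z (p i) ω)) ∂P
      = ENNReal.ofReal (Real.exp (∑ i, ∫ ω, Z (p i) ω ∂P
          + (∑ i, ∑ i', cov[Z (p i), Z (p i'); P]) / 2)) := by
  have := hZ.isProbabilityMeasure
  have hlaw : HasGaussianLaw (fun ω => ∑ i, Z (p i) ω) P :=
    (hZ.comp_right p).hasGaussianLaw_fun_sum (I := Finset.univ)
  have hmem : ∀ i, MemLp (Z (p i)) 2 P := fun i => (hZ.hasGaussianLaw_eval (p i)).memLp_two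
  have hexp : ∀ ω, ∏ i, ENNReal.ofReal (Real.exp (Z (p i) ω))
      = ENNReal.ofReal (Real.exp (∑ i, Z (p i) ω)) := fun ω => by
    rw [Real.exp_sum, ENNReal.ofReal_prod_of_nonneg fun i _ => (Real.exp_pos _).le]
  simp_rw [hexp]
  rw [lintegral_exp_of_hasGaussianLaw hlaw,
    integral_finsetSum _ fun i _ => (hmem i).integrable one_le_two,
    ← covariance_self hlaw.aemeasurable, covariance_fun_sum_fun_sum hmem hmem]

/-! ### Moments of the bin masses -/

section Model

variable {Ω S : Type*} [MeasurableSpace Ω] [MetricSpace S] [MeasurableSpace S]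
  {P : Measure Ω} {vol : Measure S} {X : ℕ → Ω → Set S} {G : ℕ → Ω → S → ℝ}
  {μ : S → ℝ} {γ : ℕ → S → S → ℝ} {R : Set S} {d : ℕ} {bin : Fin d → Set S}

lemma AssumptionA1.covariance_shift (hA1 : AssumptionA1 P vol X G μ γ) (t a b : ℕ) (s s' : S) :
    cov[fun ω => G (t + a) ω s, fun ω => G (t + b) ω s'; P]
      = cov[fun ω => G a ω s, fun ω => G b ω s'; P] := by
  rcases le_total a b with h | h <;> obtain ⟨c, rfl⟩ := Nat.exists_eq_add_of_le h
  · rw [← add_assoc, hA1.autocov, hA1.autocov]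
  · rw [covariance_comm, ← add_assoc, hA1.autocov, covariance_comm, hA1.autocov]

/-- The largest absolute autocovariance over the region at lag `k`. -/
noncomputable def autocovBound (R : Set S) (γ : ℕ → S → S → ℝ) (k : ℕ) : ℝ :=
  (supNorm (R ×ˢ R) fun p => γ k p.1 p.2).toReal

lemma le_toReal_supNorm {α : Type*} {A : Set α} {f : α → ℝ} (h : supNorm A f < ∞) {a : α}
    (ha : a ∈ A) : |f a| ≤ (supNorm A f).toReal := by
  rw [← Real.norm_eq_abs, ← toReal_enorm]
  exact ENNReal.toReal_mono h.ne (le_iSup₂ (f := fun a (_ : a ∈ A) => ‖f a‖ₑ) a ha)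

lemma AssumptionA2.tendsto_autocovBound {S : Type*} {R : Set S} {μ : S → ℝ}
    {γ : ℕ → S → S → ℝ} (hA2 : AssumptionA2 R μ γ) :
    Tendsto (autocovBound R γ) atTop (𝓝 0) :=
  (ENNReal.tendsto_toReal ENNReal.zero_ne_top).comp hA2.autocov_tendsto

/-- `γ k` is indexed by nonnegative lags and need not be symmetric in its two points; reversing time
swaps them, and the supremum over `R ×ˢ R` covers both orders. -/
lemma covariance_le_autocovBound (hA1 : AssumptionA1 P vol X G μ γ) (hA2 : AssumptionA2 R μ γ)
    (t u : ℕ) {s s' : S} (hs : s ∈ R) (hs' : s' ∈ R) :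
    cov[fun ω => G t ω s, fun ω => G u ω s'; P] ≤ autocovBound R γ (Nat.dist t u) := by
  rcases le_total t u with h | h
  · obtain ⟨k, rfl⟩ := Nat.exists_eq_add_of_le h
    rw [hA1.autocov, Nat.dist_eq_sub_of_le h, Nat.add_sub_cancel_left]
    exact (le_abs_self _).trans (le_toReal_supNorm (f := fun p : S × S => γ k p.1 p.2)
      (hA2.autocov_bdd k) (a := (s, s')) ⟨hs, hs'⟩)
  · obtain ⟨k, rfl⟩ := Nat.exists_eq_add_of_le h
    rw [covariance_comm, hA1.autocov, Nat.dist_eq_sub_of_le_right h, Nat.add_sub_cancel_left]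
    exact (le_abs_self _).trans (le_toReal_supNorm (f := fun p : S × S => γ k p.1 p.2)
      (hA2.autocov_bdd k) (a := (s', s)) ⟨hs', hs⟩)

/-- The logarithm of `E ∏ i, Λ (t i) (x i)`. -/
noncomputable def logMoment {ι : Type*} [Fintype ι] (P : Measure Ω) (G : ℕ → Ω → S → ℝ)
    (t : ι → ℕ) (x : ι → S) : ℝ :=
  ∑ i, ∫ ω, G (t i) ω (x i) ∂P
    + (∑ i, ∑ i', cov[fun ω => G (t i) ω (x i), fun ω => G (t i') ω (x i'); P]) / 2

lemma lintegral_prod_intensity {ι : Type*} [Fintype ι] (hA1 : AssumptionA1 P vol X G μ γ)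
    (t : ι → ℕ) (x : ι → S) :
    ∫⁻ ω, ∏ i, ENNReal.ofReal (intensity G (t i) ω (x i)) ∂P
      = ENNReal.ofReal (Real.exp (logMoment P G t x)) :=
  lintegral_prod_exp_of_isGaussianProcess hA1.gaussian fun i => (t i, x i)

lemma logMoment_shift {ι : Type*} [Fintype ι] (hA1 : AssumptionA1 P vol X G μ γ) (u : ℕ)
    (t : ι → ℕ) (x : ι → S) : logMoment P G (fun i => u + t i) x = logMoment P G t x := by
  simp only [logMoment, hA1.mean, hA1.covariance_shift]

/-- The two off-diagonal covariance blocks have equal sums, which cancels the factor 1/2. -/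
lemma logMoment_sumElim {S ι ι' : Type*} [Fintype ι] [Fintype ι'] {G : ℕ → Ω → S → ℝ}
    (t : ι → ℕ) (x : ι → S) (t' : ι' → ℕ) (x' : ι' → S) :
    logMoment P G (Sum.elim t t') (Sum.elim x x') = logMoment P G t x + logMoment P G t' x'
      + ∑ i, ∑ i', cov[fun ω => G (t i) ω (x i), fun ω => G (t' i') ω (x' i'); P] := by
  have hswap : ∑ i', ∑ i, cov[fun ω => G (t' i') ω (x' i'), fun ω => G (t i) ω (x i); P]
      = ∑ i, ∑ i', cov[fun ω => G (t i) ω (x i), fun ω => G (t' i') ω (x' i'); P] := by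
    rw [Finset.sum_comm]
    exact Finset.sum_congr rfl fun i _ => Finset.sum_congr rfl fun i' _ => covariance_comm _ _
  simp only [logMoment, Fintype.sum_sum_type, Sum.elim_inl, Sum.elim_inr,
    Finset.sum_add_distrib, hswap]
  ring

lemma measurable_prod_intensity {ι : Type*} [Fintype ι] (hA1 : AssumptionA1 P vol X G μ γ)
    (t : ι → ℕ) :
    Measurable fun q : Ω × (ι → S) => ∏ i, ENNReal.ofReal (intensity G (t i) q.1 (q.2 i)) :=
  Finset.measurable_prod _ fun i _ => ((measurable_intensity hA1 (t i)).comp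
    (measurable_fst.prodMk ((measurable_pi_apply i).comp measurable_snd))).ennreal_ofReal

lemma prod_binMass_eq_lintegral (hbin : IsBinning vol R bin) (hA1 : AssumptionA1 P vol X G μ γ)
    {r : ℕ} (t : Fin r → ℕ) (b : Fin r → Fin d) (ω : Ω) :
    ∏ i, binMass vol G bin (t i, b i) ω
      = ∫⁻ x, ∏ i, ENNReal.ofReal (intensity G (t i) ω (x i))
          ∂(Measure.pi fun i => vol.restrict (bin (b i))) := by
  have := fun i => hbin.isFiniteMeasure (b i)
  rw [lintegral_pi_fin_prod (fun i => vol.restrict (bin (b i)))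
    (f := fun i s => ENNReal.ofReal (intensity G (t i) ω s))
    fun i => ((measurable_intensity hA1 (t i)).comp measurable_prodMk_left).ennreal_ofReal]
  rfl

lemma lintegral_prod_binMass [IsProbabilityMeasure P] (hbin : IsBinning vol R bin)
    (hA1 : AssumptionA1 P vol X G μ γ) {r : ℕ} (t : Fin r → ℕ) (b : Fin r → Fin d) :
    ∫⁻ ω, ∏ i, binMass vol G bin (t i, b i) ω ∂P
      = ∫⁻ x, ENNReal.ofReal (Real.exp (logMoment P G t x))
          ∂(Measure.pi fun i => vol.restrict (bin (b i))) := by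
  have := fun i => hbin.isFiniteMeasure (b i)
  simp_rw [prod_binMass_eq_lintegral hbin hA1]
  rw [lintegral_lintegral_swap (measurable_prod_intensity hA1 t).aemeasurable]
  simp_rw [lintegral_prod_intensity hA1]

/-- `μ` and `γ` carry no measurability assumption, so measurability comes from the representation as
an expectation. -/
lemma measurable_exp_logMoment [IsProbabilityMeasure P] {ι : Type*} [Fintype ι]
    (hA1 : AssumptionA1 P vol X G μ γ) (t : ι → ℕ) :
    Measurable fun x : ι → S => ENNReal.ofReal (Real.exp (logMoment P G t x)) := by
  simp_rw [← lintegral_prod_intensity hA1]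
  exact (measurable_prod_intensity hA1 t).lintegral_prod_left'

/-- Joint moments of bin masses are stationary in time. -/
lemma lintegral_prod_binMass_shift [IsProbabilityMeasure P] (hbin : IsBinning vol R bin)
    (hA1 : AssumptionA1 P vol X G μ γ) {r : ℕ} (u : ℕ) (t : Fin r → ℕ) (b : Fin r → Fin d) :
    ∫⁻ ω, ∏ i, binMass vol G bin (u + t i, b i) ω ∂P
      = ∫⁻ ω, ∏ i, binMass vol G bin (t i, b i) ω ∂P := by
  rw [lintegral_prod_binMass hbin hA1 (fun i => u + t i), lintegral_prod_binMass hbin hA1]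
  simp_rw [logMoment_shift hA1]

lemma IsBinning.ae_pi_mem (hbin : IsBinning vol R bin) {r : ℕ} (b : Fin r → Fin d) :
    ∀ᵐ x ∂(Measure.pi fun i => vol.restrict (bin (b i))), ∀ i, x i ∈ R := by
  have := fun i => hbin.isFiniteMeasure (b i)
  refine ae_all_iff.2 fun i => Measure.tendsto_eval_ae_ae.eventually ?_
  filter_upwards [ae_restrict_mem (hbin.measurableSet (b i))] with s hs
  rw [← hbin.iUnion_eq]
  exact Set.mem_iUnion_of_mem _ hs

lemma lintegral_prod_binMass_lt_top [IsProbabilityMeasure P] (hbin : IsBinning vol R bin)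
    (hA1 : AssumptionA1 P vol X G μ γ) (hA2 : AssumptionA2 R μ γ) {r : ℕ} (t : Fin r → ℕ)
    (b : Fin r → Fin d) : ∫⁻ ω, ∏ i, binMass vol G bin (t i, b i) ω ∂P < ∞ := by
  have := fun i => hbin.isFiniteMeasure (b i)
  rw [lintegral_prod_binMass hbin hA1]
  -- Bounds the exponent when all points lie in `R`; finite bin volumes then make the integral
  -- finite.
  set K : ℝ := ∑ _i : Fin r, (supNorm R μ).toReal
    + (∑ i, ∑ i', autocovBound R γ (Nat.dist (t i) (t i'))) / 2
  refine lt_of_le_of_lt (lintegral_mono_ae (g := fun _ => ENNReal.ofReal (Real.exp K)) ?_) ?_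
  · filter_upwards [hbin.ae_pi_mem b] with x hx
    refine ENNReal.ofReal_le_ofReal (Real.exp_le_exp.2 ?_)
    simp only [logMoment, hA1.mean, K]
    gcongr with i _ i _ i' _
    · exact (le_abs_self _).trans (le_toReal_supNorm hA2.mean_bdd (hx i))
    · exact covariance_le_autocovBound hA1 hA2 _ _ (hx i) (hx i')
  · rw [lintegral_const]
    exact ENNReal.mul_lt_top ENNReal.ofReal_lt_top (measure_lt_top _ _)

/-- Joint moments of bin masses at well separated times nearly factor. -/
theorem lintegral_prod_binMass_mul_le [IsProbabilityMeasure P] (hbin : IsBinning vol R bin)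
    (hA1 : AssumptionA1 P vol X G μ γ) (hA2 : AssumptionA2 R μ γ) {r r' : ℕ} (t : Fin r → ℕ)
    (b : Fin r → Fin d) (t' : Fin r' → ℕ) (b' : Fin r' → Fin d) :
    ∫⁻ ω, (∏ i, binMass vol G bin (t i, b i) ω) * ∏ i, binMass vol G bin (t' i, b' i) ω ∂P
      ≤ ENNReal.ofReal (Real.exp (∑ i, ∑ i', autocovBound R γ (Nat.dist (t i) (t' i'))))
        * ((∫⁻ ω, ∏ i, binMass vol G bin (t i, b i) ω ∂P)
          * ∫⁻ ω, ∏ i, binMass vol G bin (t' i, b' i) ω ∂P) := by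
  have := fun i => hbin.isFiniteMeasure (b i)
  have := fun i => hbin.isFiniteMeasure (b' i)
  set κ := Measure.pi fun i => vol.restrict (bin (b i))
  set κ' := Measure.pi fun i => vol.restrict (bin (b' i))
  have hω : ∀ ω, (∏ i, binMass vol G bin (t i, b i) ω) * ∏ i, binMass vol G bin (t' i, b' i) ω
      = ∫⁻ z, ∏ i, ENNReal.ofReal (intensity G (Sum.elim t t' i) ω (Sum.elim z.1 z.2 i))
          ∂(κ.prod κ') := by
    intro ω
    rw [prod_binMass_eq_lintegral hbin hA1, prod_binMass_eq_lintegral hbin hA1,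
      ← lintegral_prod_mul]
    · refine lintegral_congr fun z => ?_
      rw [Fintype.prod_sum_type]
      rfl
    · exact ((measurable_prod_intensity hA1 t).comp measurable_prodMk_left).aemeasurable
    · exact ((measurable_prod_intensity hA1 t').comp measurable_prodMk_left).aemeasurable
  have hmeas : Measurable fun q : Ω × ((Fin r → S) × (Fin r' → S)) =>
      ∏ i, ENNReal.ofReal (intensity G (Sum.elim t t' i) q.1 (Sum.elim q.2.1 q.2.2 i)) := by
    refine (measurable_prod_intensity hA1 (Sum.elim t t')).comp
      (measurable_fst.prodMk (measurable_pi_lambda _ fun i => ?_))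
    cases i with
    | inl i => exact (measurable_pi_apply i).comp (measurable_fst.comp measurable_snd)
    | inr i => exact (measurable_pi_apply i).comp (measurable_snd.comp measurable_snd)
  simp_rw [hω]
  rw [lintegral_lintegral_swap hmeas.aemeasurable, lintegral_prod_binMass hbin hA1,
    lintegral_prod_binMass hbin hA1, ← lintegral_prod_mul
      (measurable_exp_logMoment hA1 t).aemeasurable (measurable_exp_logMoment hA1 t').aemeasurable,
    ← lintegral_const_mul' _ _ ENNReal.ofReal_ne_top]
  refine lintegral_mono_ae ?_
  filter_upwards [Measure.quasiMeasurePreserving_fst.ae (hbin.ae_pi_mem b),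
    Measure.quasiMeasurePreserving_snd.ae (hbin.ae_pi_mem b')] with z hz hz'
  rw [lintegral_prod_intensity hA1, logMoment_sumElim,
    ← ENNReal.ofReal_mul (Real.exp_pos _).le, ← ENNReal.ofReal_mul (Real.exp_pos _).le,
    ← Real.exp_add, ← Real.exp_add, add_comm]
  gcongr with i _ i' _
  exact covariance_le_autocovBound hA1 hA2 _ _ (hz i) (hz' i')

end Model

/-! ### Laws of large numbers for the bin counts -/

section Monomials

variable {Ω S : Type*} {X : ℕ → Ω → Set S} {d : ℕ} {bin : Fin d → Set S}

/-- The exponents of the monomial with one factor at time `t + k i` in bin `b i` for each `i`. -/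
noncomputable def lagExponents {r : ℕ} (k : Fin r → ℕ) (b : Fin r → Fin d) (t : ℕ) :
    ℕ × Fin d →₀ ℕ :=
  ∑ i, Finsupp.single (t + k i, b i) 1

lemma lagExponents_support_subset {r : ℕ} (k : Fin r → ℕ) (b : Fin r → Fin d) (t : ℕ) :
    (lagExponents k b t).support ⊆ Finset.univ.image fun i => (t + k i, b i) := by
  intro p hp
  obtain ⟨i, -, hi⟩ := Finset.mem_biUnion.1 (Finsupp.support_finsetSum hp)
  have := Finsupp.support_single_subset hi
  exact Finset.mem_image.2 ⟨i, Finset.mem_univ i, (Finset.mem_singleton.1 this).symm⟩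

lemma massMonomial_add [MeasurableSpace S] {vol : Measure S} {G : ℕ → Ω → S → ℝ}
    (a a' : ℕ × Fin d →₀ ℕ) (ω : Ω) : massMonomial vol G bin (a + a') ω
      = massMonomial vol G bin a ω * massMonomial vol G bin a' ω :=
  Finsupp.prod_add_index' (fun _ => pow_zero _) fun _ _ _ => pow_add _ _ _

lemma massMonomial_lagExponents [MeasurableSpace S] {vol : Measure S} {G : ℕ → Ω → S → ℝ}
    {r : ℕ} (k : Fin r → ℕ) (b : Fin r → Fin d) (t : ℕ) (ω : Ω) :
    massMonomial vol G bin (lagExponents k b t) ω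
      = ∏ i, binMass vol G bin (t + k i, b i) ω := by
  rw [massMonomial, lagExponents,
    ← Finsupp.prod_finsetSum_index (fun _ => pow_zero _) fun _ _ _ => pow_add _ _ _]
  refine Finset.prod_congr rfl fun i _ => ?_
  simp

/-- Unlike powers, falling factorials do not turn sums of exponents into products, so no bin at a
given time may be shared. -/
lemma countMonomial_add {a a' : ℕ × Fin d →₀ ℕ} (h : Disjoint a.support a'.support) (ω : Ω) :
    countMonomial X bin (a + a') ω = countMonomial X bin a ω * countMonomial X bin a' ω :=
  Finsupp.prod_add_index_of_disjoint h _

lemma countMonomial_single (p : ℕ × Fin d) (m : ℕ) (ω : Ω) :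
    countMonomial X bin (Finsupp.single p m) ω = (binCount X bin p ω).descFactorial m :=
  Finsupp.prod_single_index (Nat.descFactorial_zero _)

lemma countMonomial_lagExponents_le {r : ℕ} (k : Fin r → ℕ) (b : Fin r → Fin d) (t : ℕ)
    (ω : Ω) : countMonomial X bin (lagExponents k b t) ω
      ≤ ∏ i, binCount X bin (t + k i, b i) ω := by
  have hpow : ∏ i, binCount X bin (t + k i, b i) ω
      = (lagExponents k b t).prod fun p m => binCount X bin p ω ^ m := by
    rw [lagExponents,
      ← Finsupp.prod_finsetSum_index (fun _ => pow_zero _) fun _ _ _ => pow_add _ _ _]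
    refine Finset.prod_congr rfl fun i _ => ?_
    simp
  rw [hpow]
  exact Finset.prod_le_prod' fun p _ => Nat.descFactorial_le_pow _ _

/-- For `m ≥ 2 q` every factor of the falling factorial is at least `m / 2`; smaller `m` go into the
constant. -/
lemma pow_le_descFactorial (m q : ℕ) : m ^ q ≤ 2 ^ q * m.descFactorial q + (2 * q) ^ q := by
  rcases le_total m (2 * q) with h | h
  · exact (Nat.pow_le_pow_left h q).trans (Nat.le_add_left _ _)
  · calc m ^ q ≤ (2 * (m + 1 - q)) ^ q := Nat.pow_le_pow_left (by omega) q
      _ = 2 ^ q * (m + 1 - q) ^ q := Nat.mul_pow _ _ _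
      _ ≤ 2 ^ q * m.descFactorial q :=
        Nat.mul_le_mul_left _ (Nat.pow_sub_le_descFactorial _ _)
      _ ≤ _ := Nat.le_add_right _ _

lemma prod_le_one_add_sum_pow {r : ℕ} (x : Fin r → ℕ) : ∏ i, x i ≤ 1 + ∑ i, x i ^ r := by
  rcases Nat.eq_zero_or_pos r with rfl | hr
  · simp
  · obtain ⟨i₀, -, hi₀⟩ := Finset.exists_max_image Finset.univ x ⟨⟨0, hr⟩, Finset.mem_univ _⟩
    calc ∏ i, x i ≤ ∏ _i : Fin r, x i₀ := Finset.prod_le_prod' hi₀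
      _ = x i₀ ^ r := by simp
      _ ≤ ∑ i, x i ^ r := Finset.single_le_sum (f := fun i => x i ^ r)
          (fun _ _ => Nat.zero_le _) (Finset.mem_univ i₀)
      _ ≤ _ := Nat.le_add_left _ _

end Monomials

section Model

variable {Ω S : Type*} [MeasurableSpace Ω] [MetricSpace S] [MeasurableSpace S]
  {P : Measure Ω} {vol : Measure S} {X : ℕ → Ω → Set S} {G : ℕ → Ω → S → ℝ}
  {μ : S → ℝ} {γ : ℕ → S → S → ℝ} {R : Set S} {d : ℕ} {bin : Fin d → Set S}

lemma measurable_countMonomial (hbin : IsBinning vol R bin) (hA1 : AssumptionA1 P vol X G μ γ)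
    (a : ℕ × Fin d →₀ ℕ) : Measurable (countMonomial X bin a) :=
  Finset.measurable_prod _ fun p _ =>
    (measurable_of_countable fun m : ℕ => m.descFactorial (a p)).comp
      (measurable_binCount hbin hA1 p)

/-- Stationarity makes the bound independent of time, and summing over `j` makes it independent of
the bin. -/
lemma exists_lintegral_binCount_pow_le [IsProbabilityMeasure P] (hbin : IsBinning vol R bin)
    (hA1 : AssumptionA1 P vol X G μ γ) (hA2 : AssumptionA2 R μ γ) (q : ℕ) :
    ∃ B < ∞, ∀ p, ∫⁻ ω, (binCount X bin p ω : ℝ≥0∞) ^ q ∂P ≤ B := by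
  refine ⟨∑ j, (2 ^ q * (∫⁻ ω, ∏ _i : Fin q, binMass vol G bin (0, j) ω ∂P) + (2 * q) ^ q),
    ENNReal.sum_lt_top.2 fun j _ => ENNReal.add_lt_top.2
      ⟨ENNReal.mul_lt_top (by finiteness)
        (lintegral_prod_binMass_lt_top hbin hA1 hA2 (fun _ => 0) fun _ => j), by finiteness⟩,
    fun p => ?_⟩
  have hmean : ∫⁻ ω, ((binCount X bin p ω).descFactorial q : ℝ≥0∞) ∂P
      = ∫⁻ ω, ∏ _i : Fin q, binMass vol G bin (0, p.2) ω ∂P := by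
    have h := lintegral_countMonomial hbin hA1 (Finsupp.single p q)
    simp_rw [countMonomial_single] at h
    rw [h, ← lintegral_prod_binMass_shift hbin hA1 p.1 (fun _ => 0) fun _ => p.2]
    refine lintegral_congr fun ω => ?_
    simp [massMonomial]
  have hmeas : Measurable fun ω => ((binCount X bin p ω).descFactorial q : ℝ≥0∞) :=
    (measurable_of_countable fun m : ℕ => (m.descFactorial q : ℝ≥0∞)).comp
      (measurable_binCount hbin hA1 p)
  calc ∫⁻ ω, (binCount X bin p ω : ℝ≥0∞) ^ q ∂P
      ≤ ∫⁻ ω, (2 ^ q * ((binCount X bin p ω).descFactorial q : ℝ≥0∞) + (2 * q) ^ q) ∂P :=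
        lintegral_mono fun ω => by
          have := (Nat.cast_le (α := ℝ≥0∞)).2 (pow_le_descFactorial (binCount X bin p ω) q)
          push_cast at this
          exact this
    _ = 2 ^ q * (∫⁻ ω, ∏ _i : Fin q, binMass vol G bin (0, p.2) ω ∂P) + (2 * q) ^ q := by
        rw [lintegral_add_left (hmeas.const_mul _), lintegral_const_mul _ hmeas, hmean,
          lintegral_const, measure_univ, mul_one]
    _ ≤ _ := Finset.single_le_sum (f := fun j =>
          2 ^ q * (∫⁻ ω, ∏ _i : Fin q, binMass vol G bin (0, j) ω ∂P) + (2 * q : ℝ≥0∞) ^ q)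
          (fun _ _ => zero_le) (Finset.mem_univ p.2)

lemma exists_lintegral_countMonomial_sq_le [IsProbabilityMeasure P]
    (hbin : IsBinning vol R bin) (hA1 : AssumptionA1 P vol X G μ γ) (hA2 : AssumptionA2 R μ γ)
    {r : ℕ} (k : Fin r → ℕ) (b : Fin r → Fin d) :
    ∃ B < ∞, ∀ t,
      ∫⁻ ω, (countMonomial X bin (lagExponents k b t) ω : ℝ≥0∞) ^ 2 ∂P ≤ B := by
  obtain ⟨B, hB, hle⟩ := exists_lintegral_binCount_pow_le hbin hA1 hA2 (2 * r)
  refine ⟨1 + r * B, by finiteness, fun t => ?_⟩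
  have hmeas : ∀ i, Measurable fun ω => (binCount X bin (t + k i, b i) ω : ℝ≥0∞) ^ (2 * r) :=
    fun i => ((measurable_of_countable fun m : ℕ => (m : ℝ≥0∞)).comp
      (measurable_binCount hbin hA1 _)).pow_const _
  calc ∫⁻ ω, (countMonomial X bin (lagExponents k b t) ω : ℝ≥0∞) ^ 2 ∂P
      ≤ ∫⁻ ω, (1 + ∑ i, (binCount X bin (t + k i, b i) ω : ℝ≥0∞) ^ (2 * r)) ∂P := by
        refine lintegral_mono fun ω => ?_
        have h1 := Nat.pow_le_pow_left
          (countMonomial_lagExponents_le (X := X) (bin := bin) k b t ω) 2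
        have h2 := prod_le_one_add_sum_pow fun i => binCount X bin (t + k i, b i) ω ^ 2
        simp_rw [← pow_mul] at h2
        rw [Finset.prod_pow] at h2
        have h3 := (Nat.cast_le (α := ℝ≥0∞)).2 (h1.trans h2)
        push_cast at h3
        exact h3
    _ = 1 + ∑ i, ∫⁻ ω, (binCount X bin (t + k i, b i) ω : ℝ≥0∞) ^ (2 * r) ∂P := by
        rw [lintegral_add_left measurable_const, lintegral_finsetSum _ fun i _ => hmeas i]
        simp
    _ ≤ 1 + ∑ _i : Fin r, B := by gcongr with i; exact hle _
    _ = 1 + r * B := by simp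

lemma tendsto_sum_autocovBound {S : Type*} {R : Set S} {μ : S → ℝ} {γ : ℕ → S → S → ℝ}
    (hA2 : AssumptionA2 R μ γ) {r : ℕ} (k : Fin r → ℕ) :
    Tendsto (fun h => ∑ i, ∑ i', autocovBound R γ (Nat.dist (k i) (h + k i'))) atTop (𝓝 0) := by
  have : ∀ i i', Tendsto (fun h => autocovBound R γ (Nat.dist (k i) (h + k i'))) atTop (𝓝 0) := by
    intro i i'
    refine hA2.tendsto_autocovBound.comp (tendsto_atTop_mono (f := fun h => h - k i) ?_
      (tendsto_sub_atTop_nat _))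
    intro h
    rw [Nat.dist]
    omega
  simpa using tendsto_finsetSum Finset.univ fun i _ =>
    tendsto_finsetSum Finset.univ fun i' _ => this i i'

/-- The averages of lagged count monomials converge to the mean of the mass monomial. -/
theorem tendstoInProb_average_countMonomial [IsProbabilityMeasure P]
    (hbin : IsBinning vol R bin) (hA1 : AssumptionA1 P vol X G μ γ) (hA2 : AssumptionA2 R μ γ)
    {r : ℕ} (k : Fin r → ℕ) (b : Fin r → Fin d) :
    TendstoInProb P (fun (n : ℕ) ω => (n : ℝ)⁻¹ * ∑ t ∈ Finset.range n,
      (countMonomial X bin (lagExponents k b t) ω : ℝ)) atTop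
      (∫⁻ ω, ∏ i, binMass vol G bin (k i, b i) ω ∂P).toReal := by
  obtain ⟨B, hB, hsq⟩ := exists_lintegral_countMonomial_sq_le hbin hA1 hA2 k b
  set M := ∫⁻ ω, ∏ i, binMass vol G bin (k i, b i) ω ∂P with hM
  have hMtop : M < ∞ := lintegral_prod_binMass_lt_top hbin hA1 hA2 k b
  set δ : ℕ → ℝ := fun h => ∑ i, ∑ i', autocovBound R γ (Nat.dist (k i) (h + k i')) with hδ
  -- Beyond lag `K` the monomials at `t` and `t + h` share no time: `t + k i = t + h + k i'` would
  -- force `k i > K`.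
  set K := Finset.univ.sup k with hK
  have hmeas : ∀ t, Measurable fun ω =>
      (countMonomial X bin (lagExponents k b t) ω : ℝ≥0∞) := fun t =>
    (measurable_of_countable fun m : ℕ => (m : ℝ≥0∞)).comp (measurable_countMonomial hbin hA1 _)
  have hmeasR : ∀ t, Measurable fun ω =>
      (countMonomial X bin (lagExponents k b t) ω : ℝ) := fun t =>
    (measurable_of_countable fun m : ℕ => (m : ℝ)).comp (measurable_countMonomial hbin hA1 _)
  have hmean : ∀ t, ∫⁻ ω, (countMonomial X bin (lagExponents k b t) ω : ℝ≥0∞) ∂P = M := by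
    intro t
    rw [lintegral_countMonomial hbin hA1]
    simp_rw [massMonomial_lagExponents]
    exact lintegral_prod_binMass_shift hbin hA1 t k b
  have hcross : ∀ t h, ∫⁻ ω, (countMonomial X bin (lagExponents k b t) ω : ℝ≥0∞)
      * countMonomial X bin (lagExponents k b (t + h)) ω ∂P ≤ B + B := by
    intro t h
    calc _ ≤ ∫⁻ ω, ((countMonomial X bin (lagExponents k b t) ω : ℝ≥0∞) ^ 2
          + (countMonomial X bin (lagExponents k b (t + h)) ω : ℝ≥0∞) ^ 2) ∂P := by
          refine lintegral_mono fun ω => ?_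
          have hab : ∀ x y : ℕ, x * y ≤ x ^ 2 + y ^ 2 := fun x y => by
            rcases le_total x y with hxy | hxy <;> nlinarith
          have := (Nat.cast_le (α := ℝ≥0∞)).2 (hab
            (countMonomial X bin (lagExponents k b t) ω)
            (countMonomial X bin (lagExponents k b (t + h)) ω))
          push_cast at this
          exact this
      _ ≤ B + B := by
          rw [lintegral_add_left ((hmeas t).pow_const 2)]
          exact add_le_add (hsq t) (hsq (t + h))
  have hsep : ∀ t h, K < h → ∫⁻ ω, (countMonomial X bin (lagExponents k b t) ω : ℝ≥0∞)
      * countMonomial X bin (lagExponents k b (t + h)) ω ∂P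
      ≤ ENNReal.ofReal (Real.exp (δ h)) * (M * M) := by
    intro t h hh
    have hdisj : Disjoint (lagExponents k b t).support (lagExponents k b (t + h)).support := by
      refine Disjoint.mono (lagExponents_support_subset k b t)
        (lagExponents_support_subset k b (t + h)) (Finset.disjoint_left.2 fun p hp hp' => ?_)
      obtain ⟨i, -, rfl⟩ := Finset.mem_image.1 hp
      obtain ⟨i', -, hi'⟩ := Finset.mem_image.1 hp'
      have h1 := (Prod.mk.inj hi').1
      have h2 : k i ≤ K := Finset.le_sup (Finset.mem_univ i)
      omega
    have h1 := lintegral_countMonomial hbin hA1 (lagExponents k b t + lagExponents k b (t + h))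
    simp_rw [countMonomial_add hdisj, massMonomial_add, massMonomial_lagExponents,
      Nat.cast_mul] at h1
    rw [h1]
    refine (lintegral_prod_binMass_mul_le hbin hA1 hA2 (fun i => t + k i) b
      (fun i => t + h + k i) b).trans (le_of_eq ?_)
    rw [lintegral_prod_binMass_shift hbin hA1, lintegral_prod_binMass_shift hbin hA1, hδ]
    simp_rw [add_assoc, Nat.dist_add_add_left]
    rfl
  have hcast : ∀ m : ℕ, ENNReal.ofReal (m : ℝ) = m := ENNReal.ofReal_natCast
  -- The finitely many lags up to `K` need only a crude bound, here from `x y ≤ x² + y²`.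
  refine tendstoInProb_average (b := fun h => if K < h then (Real.exp (δ h) - 1) * M.toReal ^ 2
    else (B + B).toReal) (fun t => ?_) (fun t => ?_) ?_ fun t h => ?_
  · rw [memLp_two_iff_integrable_sq (hmeasR t).aestronglyMeasurable]
    refine ⟨((hmeasR t).pow_const 2).aestronglyMeasurable, ?_⟩
    rw [hasFiniteIntegral_iff_ofReal (Eventually.of_forall fun ω => by positivity)]
    refine lt_of_le_of_lt (le_of_eq ?_) ((hsq t).trans_lt hB)
    refine lintegral_congr fun ω => ?_
    rw [ENNReal.ofReal_pow (Nat.cast_nonneg _), hcast]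
  · rw [integral_eq_lintegral_of_nonneg_ae (Eventually.of_forall fun ω => Nat.cast_nonneg _)
      (hmeasR t).aestronglyMeasurable]
    simp_rw [hcast, hmean t]
  · have h0 : Tendsto (fun h => (Real.exp (δ h) - 1) * M.toReal ^ 2) atTop (𝓝 0) := by
      have := (((Real.continuous_exp.tendsto 0).comp (tendsto_sum_autocovBound hA2 k)).sub_const
        1).mul_const (M.toReal ^ 2)
      simpa using this
    refine h0.congr' ?_
    filter_upwards [eventually_gt_atTop K] with h hh
    rw [if_pos hh]
  · have hprod : Measurable fun ω => (countMonomial X bin (lagExponents k b t) ω : ℝ)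
        * countMonomial X bin (lagExponents k b (t + h)) ω := (hmeasR t).mul (hmeasR (t + h))
    rw [integral_eq_lintegral_of_nonneg_ae
      (Eventually.of_forall fun ω => mul_nonneg (Nat.cast_nonneg _) (Nat.cast_nonneg _))
      hprod.aestronglyMeasurable]
    simp_rw [ENNReal.ofReal_mul (Nat.cast_nonneg (α := ℝ) _), hcast]
    split_ifs with hh
    · have := ENNReal.toReal_mono (by finiteness) (hsep t h hh)
      rw [ENNReal.toReal_mul, ENNReal.toReal_mul, ENNReal.toReal_ofReal (Real.exp_pos _).le] at this
      linarith
    · have := ENNReal.toReal_mono (by finiteness) (hcross t h)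
      nlinarith [sq_nonneg M.toReal]

end Model

/-! ### Population quantities as moments of the bin masses -/

section Model

variable {Ω S : Type*} [MeasurableSpace Ω] [MetricSpace S] [MeasurableSpace S]
  {P : Measure Ω} {vol : Measure S} {X : ℕ → Ω → Set S} {G : ℕ → Ω → S → ℝ}
  {μ : S → ℝ} {γ : ℕ → S → S → ℝ} {R : Set S} {d : ℕ} {bin : Fin d → Set S}

lemma nuFun_eq (hA1 : AssumptionA1 P vol X G μ γ) (s : S) :
    nuFun P G s = (∫⁻ ω, ENNReal.ofReal (intensity G 0 ω s) ∂P).toReal :=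
  integral_eq_lintegral_of_nonneg_ae (Eventually.of_forall fun _ => (Real.exp_pos _).le)
    ((measurable_intensity hA1 0).comp measurable_prodMk_right).aestronglyMeasurable

lemma cFun_eq (hA1 : AssumptionA1 P vol X G μ γ) (k : ℕ) (s s' : S) :
    cFun P G k s s' = (∫⁻ ω, ENNReal.ofReal (intensity G 0 ω s)
      * ENNReal.ofReal (intensity G k ω s') ∂P).toReal := by
  have hmeas : Measurable fun ω => intensity G 0 ω s * intensity G k ω s' :=
    ((measurable_intensity hA1 0).comp measurable_prodMk_right).mul
      ((measurable_intensity hA1 k).comp measurable_prodMk_right)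
  have hnonneg : ∀ ω, 0 ≤ intensity G 0 ω s * intensity G k ω s' := fun ω =>
    (mul_pos (Real.exp_pos _) (Real.exp_pos _)).le
  rw [cFun, integral_eq_lintegral_of_nonneg_ae (Eventually.of_forall hnonneg)
    hmeas.aestronglyMeasurable]
  congr 1
  exact lintegral_congr fun ω => ENNReal.ofReal_mul (Real.exp_pos _).le

lemma lintegral_intensity (hA1 : AssumptionA1 P vol X G μ γ) (t : ℕ) (s : S) :
    ∫⁻ ω, ENNReal.ofReal (intensity G t ω s) ∂P
      = ENNReal.ofReal (Real.exp (μ s + γ 0 s s / 2)) := by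
  have h := lintegral_prod_intensity hA1 (fun _ : Unit => t) fun _ => s
  have h0 := hA1.autocov t 0 s s
  rw [add_zero] at h0
  simpa [logMoment, hA1.mean, h0] using h

lemma lintegral_intensity_mul_intensity (hA1 : AssumptionA1 P vol X G μ γ) (k : ℕ) (s s' : S) :
    ∫⁻ ω, ENNReal.ofReal (intensity G 0 ω s) * ENNReal.ofReal (intensity G k ω s') ∂P
      = ENNReal.ofReal (Real.exp (μ s + γ 0 s s / 2 + (μ s' + γ 0 s' s' / 2) + γ k s s')) := by
  have h := lintegral_prod_intensity hA1 (Sum.elim (fun _ : Unit => 0) fun _ : Unit => k)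
    (Sum.elim (fun _ => s) fun _ => s')
  have h0 := hA1.autocov 0 0 s s
  have h1 := hA1.autocov k 0 s' s'
  have h2 := hA1.autocov 0 k s s'
  simp only [add_zero, zero_add] at h0 h1 h2
  rw [logMoment_sumElim] at h
  simpa [logMoment, hA1.mean, h0, h1, h2] using h

lemma nu_eq [IsProbabilityMeasure P] (hbin : IsBinning vol R bin)
    (hA1 : AssumptionA1 P vol X G μ γ) (j : Fin d) :
    nu P vol G bin j = (∫⁻ ω, binMass vol G bin (0, j) ω ∂P).toReal := by
  have := hbin.isFiniteMeasure j
  simp_rw [nu, nuFun_eq hA1]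
  rw [integral_toReal (measurable_intensity hA1 0).ennreal_ofReal.lintegral_prod_left'.aemeasurable
    (Eventually.of_forall fun s => by
      rw [lintegral_intensity hA1]
      exact ENNReal.ofReal_lt_top)]
  congr 1
  exact (lintegral_lintegral_swap (measurable_intensity hA1 0).ennreal_ofReal.aemeasurable).symm

lemma C_apply_eq [IsProbabilityMeasure P] (hbin : IsBinning vol R bin)
    (hA1 : AssumptionA1 P vol X G μ γ) (hA2 : AssumptionA2 R μ γ) (k : ℕ) (j j' : Fin d) :
    C P vol G bin k j j' = (∫⁻ ω, binMass vol G bin (0, j) ω * binMass vol G bin (k, j') ω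
      ∂P).toReal := by
  have := hbin.isFiniteMeasure j
  have := hbin.isFiniteMeasure j'
  have hm := fun t => (measurable_intensity hA1 t).ennreal_ofReal
  have hjoint : ∀ s, Measurable fun q : Ω × S => ENNReal.ofReal (intensity G 0 q.1 s)
      * ENNReal.ofReal (intensity G k q.1 q.2) := fun s =>
    ((hm 0).comp (measurable_fst.prodMk measurable_const)).mul (hm k)
  have hmass : Measurable fun q : Ω × S => ENNReal.ofReal (intensity G 0 q.1 q.2)
      * binMass vol G bin (k, j') q.1 :=
    (hm 0).mul ((measurable_binMass hbin hA1 (k, j')).comp measurable_fst)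
  have hinner : ∀ s, ∫ s' in bin j', cFun P G k s s' ∂vol
      = (∫⁻ ω, ENNReal.ofReal (intensity G 0 ω s) * binMass vol G bin (k, j') ω ∂P).toReal := by
    intro s
    simp_rw [cFun_eq hA1]
    rw [integral_toReal (hjoint s).lintegral_prod_left'.aemeasurable
      (Eventually.of_forall fun s' => by
        rw [lintegral_intensity_mul_intensity hA1]
        exact ENNReal.ofReal_lt_top),
      ← lintegral_lintegral_swap (hjoint s).aemeasurable]
    congr 1
    refine lintegral_congr fun ω => ?_
    exact lintegral_const_mul (ENNReal.ofReal (intensity G 0 ω s))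
      ((hm k).comp (measurable_prodMk_left (x := ω)))
  have htotal : ∫⁻ s in bin j, ∫⁻ ω, ENNReal.ofReal (intensity G 0 ω s)
        * binMass vol G bin (k, j') ω ∂P ∂vol
      = ∫⁻ ω, binMass vol G bin (0, j) ω * binMass vol G bin (k, j') ω ∂P := by
    rw [← lintegral_lintegral_swap hmass.aemeasurable]
    refine lintegral_congr fun ω => ?_
    exact lintegral_mul_const (binMass vol G bin (k, j') ω)
      ((hm 0).comp (measurable_prodMk_left (x := ω)))
  -- Makes the outer integrand almost everywhere finite, so that `toReal` commutes with the
  -- integral.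
  have hfin : ∫⁻ ω, binMass vol G bin (0, j) ω * binMass vol G bin (k, j') ω ∂P < ∞ := by
    simpa [Fin.prod_univ_two] using
      lintegral_prod_binMass_lt_top hbin hA1 hA2 ![0, k] ![j, j']
  have hmeas := hmass.lintegral_prod_left' (μ := P)
  change ∫ s in bin j, ∫ s' in bin j', cFun P G k s s' ∂vol ∂vol = _
  simp_rw [hinner]
  rw [integral_toReal hmeas.aemeasurable (ae_lt_top hmeas (htotal ▸ hfin.ne)), htotal]

/-- The integrand is a positive exponential everywhere and each bin has positive volume. -/
lemma lintegral_prod_binMass_pos [IsProbabilityMeasure P] (hbin : IsBinning vol R bin)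
    (hA1 : AssumptionA1 P vol X G μ γ) {r : ℕ} (t : Fin r → ℕ) (b : Fin r → Fin d) :
    0 < ∫⁻ ω, ∏ i, binMass vol G bin (t i, b i) ω ∂P := by
  have := fun i => hbin.isFiniteMeasure (b i)
  rw [lintegral_prod_binMass hbin hA1, lintegral_pos_iff_support (measurable_exp_logMoment hA1 t)]
  have hsupp : (Function.support fun x : Fin r → S =>
      ENNReal.ofReal (Real.exp (logMoment P G t x))) = Set.univ := by
    ext x
    simp [Real.exp_pos]
  rw [hsupp, Measure.pi_univ]
  simp only [Measure.restrict_apply_univ]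
  exact pos_iff_ne_zero.2 (Finset.prod_ne_zero_iff.2 fun i _ => (hbin.vol_pos (b i)).ne')

lemma nu_pos [IsProbabilityMeasure P] (hbin : IsBinning vol R bin)
    (hA1 : AssumptionA1 P vol X G μ γ) (hA2 : AssumptionA2 R μ γ) (j : Fin d) :
    0 < nu P vol G bin j := by
  rw [nu_eq hbin hA1]
  refine ENNReal.toReal_pos ?_ ?_
  · simpa using (lintegral_prod_binMass_pos hbin hA1 ![0] ![j]).ne'
  · simpa using (lintegral_prod_binMass_lt_top hbin hA1 hA2 ![0] ![j]).ne

lemma C_apply_pos [IsProbabilityMeasure P] (hbin : IsBinning vol R bin)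
    (hA1 : AssumptionA1 P vol X G μ γ) (hA2 : AssumptionA2 R μ γ) (k : ℕ) (j j' : Fin d) :
    0 < C P vol G bin k j j' := by
  rw [C_apply_eq hbin hA1 hA2]
  refine ENNReal.toReal_pos ?_ ?_
  · simpa [Fin.prod_univ_two] using
      (lintegral_prod_binMass_pos hbin hA1 ![0, k] ![j, j']).ne'
  · simpa [Fin.prod_univ_two] using
      (lintegral_prod_binMass_lt_top hbin hA1 hA2 ![0, k] ![j, j']).ne

/-- If the autocovariance at lag `k` vanishes on the region, so does `Γ_k`. -/
theorem Gam_eq_zero [IsProbabilityMeasure P] (hbin : IsBinning vol R bin)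
    (hA1 : AssumptionA1 P vol X G μ γ) (hA2 : AssumptionA2 R μ γ) {k : ℕ}
    (hk : ∀ s ∈ R, ∀ s' ∈ R, γ k s s' = 0) : Gam P vol G bin k = 0 := by
  have hmem : ∀ j, bin j ⊆ R := fun j => hbin.iUnion_eq ▸ Set.subset_iUnion bin j
  have hc : ∀ s ∈ R, ∀ s' ∈ R, cFun P G k s s' = nuFun P G s * nuFun P G s' := by
    intro s hs s' hs'
    rw [cFun_eq hA1, nuFun_eq hA1, nuFun_eq hA1, lintegral_intensity_mul_intensity hA1,
      lintegral_intensity hA1, lintegral_intensity hA1, hk s hs s' hs',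
      ENNReal.toReal_ofReal (Real.exp_pos _).le, ENNReal.toReal_ofReal (Real.exp_pos _).le,
      ENNReal.toReal_ofReal (Real.exp_pos _).le, add_zero, Real.exp_add]
  ext j j'
  have hC : C P vol G bin k j j' = nu P vol G bin j * nu P vol G bin j' := by
    change ∫ s in bin j, ∫ s' in bin j', cFun P G k s s' ∂vol ∂vol = _
    rw [nu, ← integral_mul_const]
    refine setIntegral_congr_fun (hbin.measurableSet j) fun s hs => ?_
    rw [nu, ← integral_const_mul]
    exact setIntegral_congr_fun (hbin.measurableSet j') fun s' hs' =>
      hc s (hmem j hs) s' (hmem j' hs')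
  have hpos := mul_pos (nu_pos hbin hA1 hA2 j) (nu_pos hbin hA1 hA2 j')
  change Real.log (C P vol G bin k j j' / (nu P vol G bin j * nu P vol G bin j')) = 0
  rw [hC, div_self hpos.ne', Real.log_one]

/-! ### Consistency of the estimators -/

lemma tendstoInProb_nuHat [IsProbabilityMeasure P] (hbin : IsBinning vol R bin)
    (hA1 : AssumptionA1 P vol X G μ γ) (hA2 : AssumptionA2 R μ γ) (j : Fin d) :
    TendstoInProb P (fun n ω => nuHat X bin n ω j) atTop (nu P vol G bin j) := by
  have h := tendstoInProb_average_countMonomial hbin hA1 hA2 ![0] ![j]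
  have heq : ∀ t ω, (countMonomial X bin (lagExponents ![0] ![j] t) ω : ℝ) = Y X bin t ω j := by
    intro t ω
    simp [lagExponents, countMonomial_single, Y, binCount]
  simp_rw [heq] at h
  rw [nu_eq hbin hA1]
  simpa [nuHat] using h

/-- The factors coincide only when `k = 0` and `j = j'`; then `N (N - 1) = N² - N` produces the
diagonal correction in `Ĉ_0`. -/
lemma countMonomial_pair {Ω S : Type*} {X : ℕ → Ω → Set S} {d : ℕ} {bin : Fin d → Set S}
    (k : ℕ) (j j' : Fin d) (t : ℕ) (ω : Ω) :
    (countMonomial X bin (lagExponents ![0, k] ![j, j'] t) ω : ℝ)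
      = Y X bin t ω j * Y X bin (t + k) ω j'
        - if k = 0 ∧ j = j' then Y X bin t ω j else 0 := by
  have hsum : lagExponents ![0, k] ![j, j'] t
      = Finsupp.single (t, j) 1 + Finsupp.single (t + k, j') 1 := by
    simp [lagExponents, Fin.sum_univ_two]
  rw [hsum]
  split_ifs with h
  · obtain ⟨rfl, rfl⟩ := h
    rw [add_zero, ← Finsupp.single_add, countMonomial_single, Nat.cast_descFactorial_two]
    simp only [Y, binCount]
    ring
  · have hne : (t, j) ≠ (t + k, j') := fun he => h
      ⟨by have := (Prod.mk.inj he).1; omega, (Prod.mk.inj he).2⟩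
    rw [countMonomial_add (by simpa [Finsupp.support_single] using hne),
      countMonomial_single, countMonomial_single]
    simp [Y, binCount]

lemma tendstoInProb_CHat [IsProbabilityMeasure P] (hbin : IsBinning vol R bin)
    (hA1 : AssumptionA1 P vol X G μ γ) (hA2 : AssumptionA2 R μ γ) (k : ℕ) (j j' : Fin d) :
    TendstoInProb P (fun n ω => CHat X bin n k ω j j') atTop (C P vol G bin k j j') := by
  have h := tendstoInProb_average_countMonomial hbin hA1 hA2 ![0, k] ![j, j']
  simp_rw [countMonomial_pair] at h
  have hC : (∫⁻ ω, ∏ i, binMass vol G bin (![0, k] i, ![j, j'] i) ω ∂P).toReal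
      = C P vol G bin k j j' := by
    simp [C_apply_eq hbin hA1 hA2, Fin.prod_univ_two]
  rw [hC] at h
  rcases eq_or_ne k 0 with rfl | hk
  · refine h.congr' (Eventually.of_forall fun n => Eventually.of_forall fun ω => ?_)
    simp only [CHat, if_true, Matrix.sub_apply, Matrix.smul_apply, Matrix.sum_apply,
      Matrix.vecMulVec_apply, Matrix.diagonal_apply, nuHat, Pi.smul_apply, Finset.sum_apply,
      smul_eq_mul, add_zero, true_and, Finset.sum_sub_distrib, mul_sub]
    congr 1
    split_ifs <;> simp
  -- `Ĉ_k` averages `n - k` terms, so it is the earlier average along `n ↦ n - k`; for `n ≥ k` the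
  -- real and natural differences agree.
  · refine (h.comp_tendsto (tendsto_sub_atTop_nat k)).congr' ?_
    filter_upwards [eventually_ge_atTop k] with n hn
    refine Eventually.of_forall fun ω => ?_
    simp [CHat, hk, Matrix.sum_apply, Matrix.vecMulVec_apply, Nat.cast_sub hn]

lemma tendstoInProb_GamHat_apply [IsProbabilityMeasure P] (hbin : IsBinning vol R bin)
    (hA1 : AssumptionA1 P vol X G μ γ) (hA2 : AssumptionA2 R μ γ) (k : ℕ) (j j' : Fin d) :
    TendstoInProb P (fun n ω => GamHat X bin n k ω j j') atTop (Gam P vol G bin k j j') := by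
  have hν := nu_pos hbin hA1 hA2 j
  have hν' := nu_pos hbin hA1 hA2 j'
  have hC := C_apply_pos hbin hA1 hA2 k j j'
  have h := ((tendstoInProb_nuHat hbin hA1 hA2 j).prodMk
    ((tendstoInProb_CHat hbin hA1 hA2 k j j').prodMk
      (tendstoInProb_nuHat hbin hA1 hA2 j'))).comp_continuousAt
    -- Continuity is needed only at the limit, where all three coordinates are positive; the default
    -- values of inverse and logarithm elsewhere play no role.
    (φ := fun x : ℝ × ℝ × ℝ => Real.log (x.1⁻¹ * x.2.1 * x.2.2⁻¹)) (by
      refine ContinuousAt.log (((continuousAt_fst.inv₀ hν.ne').mul (by fun_prop)).mul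
        (ContinuousAt.inv₀ (by fun_prop) hν'.ne')) ?_
      have : 0 < (nu P vol G bin j)⁻¹ * C P vol G bin k j j' * (nu P vol G bin j')⁻¹ := by
        positivity
      exact this.ne')
  have hG : Real.log ((nu P vol G bin j)⁻¹ * C P vol G bin k j j' * (nu P vol G bin j')⁻¹)
      = Gam P vol G bin k j j' := by
    change _ = Real.log (C P vol G bin k j j' / (nu P vol G bin j * nu P vol G bin j'))
    congr 1
    field_simp
  rw [← hG]
  refine h.congr' (Eventually.of_forall fun n => Eventually.of_forall fun ω => ?_)
  simp [GamHat, Matrix.mul_diagonal, Matrix.diagonal_mul]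

/-- The Frobenius norm induces the product topology, so entrywise convergence suffices. -/
lemma TendstoInProb.matrix {ι m n : Type*} [Fintype m] [Fintype n] {l : Filter ι}
    {A : ι → Ω → Matrix m n ℝ} {A₀ : Matrix m n ℝ}
    (h : ∀ i j, TendstoInProb P (fun a ω => A a ω i j) l (A₀ i j)) :
    TendstoInProb P A l A₀ :=
  TendstoInProb.pi (E := fun _ => n → ℝ) fun i => TendstoInProb.pi fun j => h i j

end Model

end CoxSeries

theorem theorem2 {Ω S : Type*} [MeasurableSpace Ω] [MetricSpace S] [MeasurableSpace S]
    [BorelSpace S] (P : Measure Ω) [IsProbabilityMeasure P] (vol : Measure S)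
    (X : ℕ → Ω → Set S) (G : ℕ → Ω → S → ℝ) (μ : S → ℝ) (γ : ℕ → S → S → ℝ)
    (R : Set S) (d : ℕ) (bin : Fin d → Set S)
    (hbin : CoxSeries.IsBinning vol R bin)
    (hA1 : CoxSeries.AssumptionA1 P vol X G μ γ)
    (hA2 : CoxSeries.AssumptionA2 R μ γ) :
    (∀ k : ℕ, TendstoInMeasure P (fun n ω => CoxSeries.GamHat X bin n k ω) atTop
      (fun _ => CoxSeries.Gam P vol G bin k)) ∧
    ((CoxSeries.Gam P vol G bin 0).trace ≠ 0 →
      ∀ k : ℕ, TendstoInMeasure P (fun n ω => CoxSeries.rhoHat X bin n k ω) atTop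
        (fun _ => CoxSeries.rho P vol G bin k)) ∧
    (∀ k : ℕ, 1 ≤ k → (∀ s ∈ R, ∀ s' ∈ R, γ k s s' = 0) →
      CoxSeries.Gam P vol G bin k = 0 ∧ CoxSeries.rho P vol G bin k = 0) := by
  have hGam : ∀ k, CoxSeries.TendstoInProb P (fun n ω => CoxSeries.GamHat X bin n k ω) atTop
      (CoxSeries.Gam P vol G bin k) := fun k =>
    CoxSeries.TendstoInProb.matrix fun j j' =>
      CoxSeries.tendstoInProb_GamHat_apply hbin hA1 hA2 k j j'
  refine ⟨fun k => CoxSeries.tendstoInProb_iff.1 (hGam k),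
    fun htr k => CoxSeries.tendstoInProb_iff.1 ?_,
    fun k _ hk => ?_⟩
  · exact ((hGam k).prodMk (hGam 0)).comp_continuousAt
      (φ := fun x : Matrix (Fin d) (Fin d) ℝ × Matrix (Fin d) (Fin d) ℝ => ‖x.1‖ / x.2.trace)
      (continuousAt_fst.norm.div continuous_snd.matrix_trace.continuousAt htr)
  · have h0 := CoxSeries.Gam_eq_zero hbin hA1 hA2 hk
    exact ⟨h0, by rw [CoxSeries.rho, h0, norm_zero, zero_div]⟩
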